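/- **Setting.** Let $n\ge 1$, $m\ge 0$, and let $\|\cdot\|$ be the Euclidean norm. Let $x_{ic}\in\mathbb R^n$, let $X_{\rm free},X_{\rm goal}\subset\mathbb R^n$ be open, and let $\Omega\subset\mathbb R^m$ be bounded. Let $f$ take values in $\mathbb R^n$; it is Lipschitz in the state on $\mathbb R^n$ with constant $L_f>0$, uniformly over inputs in $\Omega$, Lebesgue measurable in the input on $\Omega$, and bounded by $M$ on $\mathbb R^n\times\Omega$. Let the running cost $g:X_{\rm free}\times\Omega\to(0,\infty)$ be Lipschitz in both arguments with constant $L_g\ge 0$. An input signal is an integrable $u:[0,\tau(u)]\to\Omega$ with $\tau(u)>0$. For $x_0\in\mathbb R^n$, $\varphi_{x_0}(u)$ is the solution on $[0,\tau(u)]$ of $x(t)=x_0+\int_0^t f(x(s),u(s))\,ds$, and $J_{x_0}(u)=\int_0^{\tau(u)}g([\varphi_{x_0}(u)](t),u(t))\,dt$. Let $\mathcal X_{x_{ic}}$ be the set of all $x:[0,\tau(x)]\to\mathbb R^n$, $\tau(x)>0$, with $x(0)=x_{ic}$ and Lipschitz constant $M$, with the distance $$d_{\mathcal X}(x,y)=\max_{0\le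 t\le\min\{\tau(x),\tau(y)\}}\|x(t)-y(t)\|+M|\tau(x)-\tau(y)| ,$$ and let $B_\varepsilon$ denote open balls (in $\mathcal X_{x_{ic}}$ or in $\mathbb R^n$). Put $\mathcal X_{\rm free}=\{x\in\mathcal X_{x_{ic}}: x(t)\in X_{\rm free}\ \forall t\}$, $\mathcal X_{\rm goal}=\{x\in\mathcal X_{\rm free}: x(\tau(x))\in X_{\rm goal}\}$, and $$\mathcal X_{\rm free}^{\varepsilon}=\{x\in\mathcal X_{x_{ic}}: B_\varepsilon(x)\subset\mathcal X_{\rm free}\text{ and } B_\varepsilon(x(t))\subset X_{\rm free}\ \forall t\in[0,\tau(x)]\},\qquad \mathcal X_{\rm goal}^{\varepsilon}=\{x\in\mathcal X_{\rm free}^\varepsilon: B_\varepsilon(x)\subset\mathcal X_{\rm goal}\}.$$ Let $\mathcal U_{\rm free},\mathcal U_{\rm goal},\mathcal U_{\rm goal}^\varepsilon$ be the inverse images of $\mathcal X_{\rm free},\mathcal X_{\rm goal},\mathcal X_{\rm goal}^\varepsilon$ under $\varphi_{x_{ic}}$. Fix a resolution $R\in\mathbb N$, $R\ge1$, a horizon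 $h=h(R)\in\mathbb N$, a scaling $\eta=\eta(R)>0$ and a finite set $\Omega_R\subset\Omega$. Let $\mathcal U_R$ be the set of piecewise constant signals given by strings of $d$ values from $\Omega_R$, $1\le d\le h$, each value held for time $1/R$; the depth of such a signal is $d$. The root ${\rm Id}$ is the empty string (duration, depth and cost $0$, not an element of $\mathcal U_{\rm goal}$). The children of a string are its extensions by one element of $\Omega_R$. Write $u_1\sim u_2$ if the terminal states $p_1,p_2$ of $\varphi_{x_{ic}}(u_1),\varphi_{x_{ic}}(u_2)$ satisfy $\lfloor\eta p_1\rfloor=\lfloor\eta p_2\rfloor$ coordinate-wise, and $u_1\prec_R u_2$ if $u_1\sim u_2$, $\tau(u_1)\le\tau(u_2)$ and $J_{x_{ic}}(u_1)\le J_{x_{ic}}(u_2)$. **The GLC algorithm.** Start with the queue $Q=\{{\rm Id}\}$ and the label set $\Sigma=\emptyset$. While $Q\ne\emptyset$: remove from $Q$ a signal $u$ of least cost; if $u\in\mathcal U_{\rm goal}$, stop and return $(J_{x_{ic}}(u),u)$. Otherwise let $S$ be the set of children of $u$, and examine each child $w$ in turn: let $z\in\Sigma$ with $z\sim w$, or $z={\tt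 NULL}$ if there is none, where $J_{x_{ic}}({\tt NULL})=\infty$; if $w\notin\mathcal U_{\rm free}$, or $z\ne{\tt NULL}$ and $z\prec_R w$, or ${\tt depth}(w)>h$, remove $w$ from $S$; else, if $J_{x_{ic}}(w)<J_{x_{ic}}(z)$, replace $\Sigma$ by $(\Sigma\setminus\{z\})\cup\{w\}$. After all children are examined, replace $Q$ by $Q\cup S$. If $Q=\emptyset$, stop and return $(\infty,{\tt NULL})$. Ties and the order in which children are examined are arbitrary. **Theorem.** Let $$c_R^{\varepsilon}=\min_{u\in\mathcal U_R\cap\mathcal U_{\rm goal}^{\varepsilon}}J_{x_{ic}}(u)\quad(\infty\text{ if the set is empty}),$$ $$\delta_{h}=\sum_{i=0}^{h}\frac{\sqrt n}{\eta}\,e^{L_f (h-i)/R},\qquad \gamma_{h}=\sum_{i=0}^{h}\frac{\sqrt n}{\eta}\,\frac{L_g}{L_f}\Bigl(e^{L_f(h-i)/R}-1\Bigr).$$ Every execution of the GLC algorithm stops after finitely many steps (with a bound on the number of steps valid for all executions). It returns either $(\infty,{\tt NULL})$ or $(J_{x_{ic}}(u),u)$ for some $u\in\mathcal U_R\cap\mathcal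 U_{\rm goal}$, and the returned cost is at most $c_R^{\delta_{h}}+\gamma_{h}$. -/

import Mathlib

open MeasureTheory Set

noncomputable section

namespace GLC

/-- States and control inputs: real coordinate space with the Euclidean norm. -/
abbrev Vec (n : ℕ) : Type := EuclideanSpace ℝ (Fin n)

/-- Problem data: initial condition, admissible states, goal states, admissible inputs,
dynamic model, running cost, and the known constants (Lipschitz constants of `f` and `g`, and the
bound on `f`). The values of `f` outside `ℝⁿ × Omega` and of `g` outside `Xfree × Omega`
are irrelevant. -/
structure ProblemData (n m : ℕ) where
  xIC : Vec n
  Xfree : Set (Vec n)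
  Xgoal : Set (Vec n)
  Omega : Set (Vec m)
  f : Vec n → Vec m → Vec n
  g : Vec n → Vec m → ℝ
  Lf : ℝ
  Lg : ℝ
  M : ℝ

/-- The standing assumptions on the problem data. -/
structure ProblemData.Admissible {n m : ℕ} (P : ProblemData n m) : Prop where
  isOpen_Xfree : IsOpen P.Xfree
  isOpen_Xgoal : IsOpen P.Xgoal
  isBounded_Omega : Bornology.IsBounded P.Omega
  /-- The running cost is strictly positive. -/
  g_pos : ∀ x ∈ P.Xfree, ∀ w ∈ P.Omega, 0 < P.g x w
  Lg_nonneg : 0 ≤ P.Lg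
  /-- The running cost is Lipschitz continuous in both arguments. -/
  g_lipschitz : ∀ x ∈ P.Xfree, ∀ y ∈ P.Xfree, ∀ v ∈ P.Omega, ∀ w ∈ P.Omega,
    |P.g x v - P.g y w| ≤ P.Lg * (‖x - y‖ + ‖v - w‖)
  Lf_pos : 0 < P.Lf
  f_lipschitz : ∀ x y, ∀ w ∈ P.Omega, ‖P.f x w - P.f y w‖ ≤ P.Lf * ‖x - y‖
  /-- `f x` is Lebesgue measurable on `Omega`: the preimage in `Omega` of a Borel set is the trace
  on `Omega` of a Lebesgue measurable set. -/
  f_measurable : ∀ x, ∀ B : Set (Vec n), MeasurableSet B →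
    ∃ T : Set (Vec m), NullMeasurableSet T volume ∧ {w ∈ P.Omega | P.f x w ∈ B} = P.Omega ∩ T
  f_bounded : ∀ x, ∀ w ∈ P.Omega, ‖P.f x w‖ ≤ P.M

/-- A function on the time interval `[0, τ]` with values in `ℝᵏ`; only the values of `toFun` on
`[0, τ]` have a meaning. Used for input signals and for trajectories. -/
structure Timed (k : ℕ) where
  τ : ℝ
  toFun : ℝ → Vec k

instance (k : ℕ) : Nonempty (Timed k) := ⟨⟨0, fun _ => 0⟩⟩

namespace ProblemData

variable {n m : ℕ} (P : ProblemData n m)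

/-- The input signal space `𝒰`. -/
def signals : Set (Timed m) :=
  {u | 0 < u.τ ∧ IntegrableOn u.toFun (Icc 0 u.τ) volume ∧ ∀ t ∈ Icc 0 u.τ, u.toFun t ∈ P.Omega}

/-- The trajectory space `𝒳_{x₀}`: trajectories starting from `x₀` with Lipschitz constant `M`. -/
def trajectories (x₀ : Vec n) : Set (Timed n) :=
  {x | 0 < x.τ ∧ x.toFun 0 = x₀ ∧
    ∀ s ∈ Icc 0 x.τ, ∀ t ∈ Icc 0 x.τ, ‖x.toFun s - x.toFun t‖ ≤ P.M * |s - t|}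

/-- The relation `φ_{x₀}` between an input signal and a trajectory: `x` has the same time domain
as `u` and solves the integral equation `x(t) = x₀ + ∫_{[0,t]} f(x(s), u(s)) ds`. -/
def IsSolution (x₀ : Vec n) (u : Timed m) (x : Timed n) : Prop :=
  u ∈ P.signals ∧ x ∈ P.trajectories x₀ ∧ x.τ = u.τ ∧
    IntegrableOn (fun s => P.f (x.toFun s) (u.toFun s)) (Icc 0 u.τ) volume ∧
    ∀ t ∈ Icc 0 u.τ, x.toFun t = x₀ + ∫ s in Icc 0 t, P.f (x.toFun s) (u.toFun s)

/-- The system map `φ_{x₀}`: the solution for the input signal `u` and initial condition `x₀`. -/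
def sysMap (x₀ : Vec n) (u : Timed m) : Timed n := Classical.epsilon (P.IsSolution x₀ u)

/-- The cost functional `J_{x₀}`. -/
def cost (x₀ : Vec n) (u : Timed m) : ℝ :=
  ∫ t in Icc 0 u.τ, P.g ((P.sysMap x₀ u).toFun t) (u.toFun t)

/-- Trajectories from the initial condition that stay in the admissible states. -/
def freeTraj : Set (Timed n) :=
  {x ∈ P.trajectories P.xIC | ∀ t ∈ Icc 0 x.τ, x.toFun t ∈ P.Xfree}

/-- Trajectories that in addition terminate in the goal states. -/
def goalTraj : Set (Timed n) := {x ∈ P.freeTraj | x.toFun x.τ ∈ P.Xgoal}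

/-- Inverse image of a set of trajectories under `φ_{x_ic}`. -/
def preimage (A : Set (Timed n)) : Set (Timed m) := {u | ∃ x ∈ A, P.IsSolution P.xIC u x}

def freeSignals : Set (Timed m) := P.preimage P.freeTraj

def goalSignals : Set (Timed m) := P.preimage P.goalTraj

/-- The metric `d_𝒳` on trajectories. -/
def trajDist (x y : Timed n) : ℝ :=
  sSup ((fun t => ‖x.toFun t - y.toFun t‖) '' Icc 0 (min x.τ y.τ)) + P.M * |x.τ - y.τ|

/-- The open ball of radius `ε` about `x` in the metric space `(𝒳_{x_ic}, d_𝒳)`. -/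
def trajBall (x : Timed n) (ε : ℝ) : Set (Timed n) :=
  {y ∈ P.trajectories P.xIC | P.trajDist x y < ε}

/-- The `ε`-interior of the set of free trajectories: the `d_𝒳`-ball about `x` consists of free
trajectories, and the Euclidean balls about the states of `x` consist of admissible states. -/
def freeInterior (ε : ℝ) : Set (Timed n) :=
  {x ∈ P.trajectories P.xIC | P.trajBall x ε ⊆ P.freeTraj ∧
    ∀ t ∈ Icc 0 x.τ, Metric.ball (x.toFun t) ε ⊆ P.Xfree}

/-- The `ε`-interior of the set of goal trajectories. -/
def goalInterior (ε : ℝ) : Set (Timed n) :=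
  {x ∈ P.freeInterior ε | P.trajBall x ε ⊆ P.goalTraj}

end ProblemData

/-! ### The discretized signal space -/

/-- Strings of control values; the string `w₁ ⋯ w_d` stands for the signal of duration `d / R` that
takes the value `w_i` on `[(i-1)/R, i/R)`. The empty string is the root `Id` of the search tree. -/
abbrev Str (m : ℕ) : Type := List (Vec m)

/-- The input signal of a string; at the terminal time it keeps the last value. -/
def Str.toSignal {m : ℕ} (R : ℕ) (s : Str m) : Timed m where
  τ := (s.length : ℝ) / R
  toFun t := s.getD (min ⌊t * R⌋₊ (s.length - 1)) 0

/-- Parameters at one resolution: the resolution `R`, the depth limit `h = h(R)`, the partition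
scaling `η = η(R)`, and the finite set `W = Ω_R` of control values. -/
structure Params (m : ℕ) where
  R : ℕ
  h : ℕ
  η : ℝ
  W : Finset (Vec m)

variable {n m : ℕ} (P : ProblemData n m) (A : Params m)

/-- The approximation `𝒰_R`: all nonempty strings over `W` of length at most `h`. -/
def stringSignals : Set (Str m) := {s | s ≠ [] ∧ s.length ≤ A.h ∧ ∀ w ∈ s, w ∈ A.W}

/-- `J_{x_ic}` on strings; it is `0` on the empty string, whose time domain is `{0}`. -/
def strCost (s : Str m) : ℝ := P.cost P.xIC (s.toSignal A.R)

/-- `J_{x_ic}` extended by `J_{x_ic}(NULL) = ∞`, where `none` is `NULL`. -/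
def optCost : Option (Str m) → EReal
  | none => ⊤
  | some s => (strCost P A s : EReal)

/-- Terminal state of the trajectory of a string. -/
def terminal (s : Str m) : Vec n := (P.sysMap P.xIC (s.toSignal A.R)).toFun (s.toSignal A.R).τ

/-- The trajectories of the two strings terminate in the same hypercube of the partition. -/
def SameCell (s t : Str m) : Prop :=
  ∀ i, ⌊A.η * terminal P A s i⌋ = ⌊A.η * terminal P A t i⌋

/-- The relation `s ≺_R t`. -/
def Prec (s t : Str m) : Prop :=
  SameCell P A s t ∧ (s.toSignal A.R).τ ≤ (t.toSignal A.R).τ ∧ strCost P A s ≤ strCost P A t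

/-- `c_R^ε`, the minimal cost over `𝒰_R ∩ 𝒰_goal^ε`; it is `∞` if that set is empty. -/
def cEps (ε : ℝ) : EReal :=
  ⨅ s ∈ {s ∈ stringSignals A | s.toSignal A.R ∈ P.preimage (P.goalInterior ε)},
    (strCost P A s : EReal)

/-- `δ_k`. -/
def deltaSum (k : ℕ) : ℝ :=
  ∑ i ∈ Finset.range (k + 1), √n / A.η * Real.exp (P.Lf * (((A.h : ℝ) - i) / A.R))

/-- `γ_k`. -/
def gammaSum (k : ℕ) : ℝ :=
  ∑ i ∈ Finset.range (k + 1),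
    √n / A.η * (P.Lg / P.Lf) * (Real.exp (P.Lf * (((A.h : ℝ) - i) / A.R)) - 1)

/-! ### The algorithm -/

/-- States of the execution of the algorithm: at the head of the while loop with the queue `Q` and
the label set `Λ`; inside the for loop, with the current set `S` of children and the set `todo` of
children that are still to be examined; or stopped, having returned a pair (cost, signal). -/
inductive State (m : ℕ) where
  | head (Q Λ : Set (Str m))
  | scan (Q Λ S todo : Set (Str m))
  | done (out : EReal × Option (Str m))

/-- The set of children of `u`. -/
def expand (u : Str m) : Set (Str m) := {s | ∃ w ∈ A.W, s = u ++ [w]}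

/-- `u` is a possible result of `pop(Q)`: an element of `Q` of least cost. -/
def IsPop (Q : Set (Str m)) (u : Str m) : Prop :=
  u ∈ Q ∧ ∀ v ∈ Q, strCost P A u ≤ strCost P A v

/-- `z` is a possible result of `find(w, Λ)`. -/
def IsFind (Λ : Set (Str m)) (w : Str m) : Option (Str m) → Prop
  | none => ∀ z ∈ Λ, ¬ SameCell P A w z
  | some z => z ∈ Λ ∧ SameCell P A w z

/-- The pruning test for a child `w` with `z = find(w, Λ)`: `w` is infeasible, or `z ≺_R w`, or `w`
is longer than the depth limit (the depth of a string is its length). -/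
def Pruned (w : Str m) (z : Option (Str m)) : Prop :=
  w.toSignal A.R ∉ P.freeSignals ∨ (∃ s, z = some s ∧ Prec P A s w) ∨ A.h < w.length

/-- One step of the algorithm. Ties in `pop` and the order in which children are examined are
left open, so the relation covers every execution. -/
inductive Step : State m → State m → Prop
  | emptyQueue (Λ : Set (Str m)) : Step (.head ∅ Λ) (.done (⊤, none))
  | goal (Q Λ : Set (Str m)) (u : Str m) (hu : IsPop P A Q u)
      (hg : u.toSignal A.R ∈ P.goalSignals) :
      Step (.head Q Λ) (.done ((strCost P A u : EReal), some u))
  | expand (Q Λ : Set (Str m)) (u : Str m) (hu : IsPop P A Q u)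
      (hg : u.toSignal A.R ∉ P.goalSignals) :
      Step (.head Q Λ) (.scan (Q \ {u}) Λ (expand A u) (expand A u))
  | prune (Q Λ S todo : Set (Str m)) (w : Str m) (z : Option (Str m)) (hw : w ∈ todo)
      (hz : IsFind P A Λ w z) (hp : Pruned P A w z) :
      Step (.scan Q Λ S todo) (.scan Q Λ (S \ {w}) (todo \ {w}))
  | relabel (Q Λ S todo : Set (Str m)) (w : Str m) (z : Option (Str m)) (hw : w ∈ todo)
      (hz : IsFind P A Λ w z) (hp : ¬ Pruned P A w z)
      (hc : (strCost P A w : EReal) < optCost P A z) :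
      Step (.scan Q Λ S todo) (.scan Q ((Λ \ {s | z = some s}) ∪ {w}) S (todo \ {w}))
  | keep (Q Λ S todo : Set (Str m)) (w : Str m) (z : Option (Str m)) (hw : w ∈ todo)
      (hz : IsFind P A Λ w z) (hp : ¬ Pruned P A w z)
      (hc : ¬ (strCost P A w : EReal) < optCost P A z) :
      Step (.scan Q Λ S todo) (.scan Q Λ S (todo \ {w}))
  | enqueue (Q Λ S : Set (Str m)) : Step (.scan Q Λ S ∅) (.head (Q ∪ S) Λ)

/-- The algorithm starts with the root in the queue and no labels. -/
def start (m : ℕ) : State m := .head {[]} ∅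

end GLC

end

namespace GLC

open Filter Topology

variable {n m : ℕ} {P : ProblemData n m} {A : Params m}

/-! ### Signals of strings -/

/-! Cost bound: take a competitor `u` whose trajectory lies in the `δ_h`-interior, and look at the
search tree when the algorithm stops; it consists of the queue `Q` and the expanded nodes `E`.
Starting from the root, consume `u` letter by letter while keeping a node `v` of the tree and the
unread suffix `r` of `u` such that `v ++ r` is nearly as good as `u` (`NearOptimal`). If `v ∈ E`,
its child by the next letter is either in the tree or dominated by some tree node `z`: the other
grounds for discarding it, infeasibility and excess depth, are excluded because `v ++ r` is free and
short enough. Replacing the child by `z` does not lengthen the string and moves the state where the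
suffix begins by at most `√n / η`. By Grönwall, with `l` letters left, this adds at most `√n/η ·
exp(L_f l/R)` to the deviation from the trajectory of `u`, and integrating the Lipschitz bound on
`g` gives the corresponding term of `γ_h` (`NearOptimal.replace`).

At most one replacement occurs for each `l < h`, so the total deviation stays strictly below `δ_h`
and the total excess cost is at most `γ_h`. The walk must stop at a node of `Q`: with `r` exhausted,
`v` would be a goal signal, and goal signals are never expanded (`IsSearchTree.exists_mem_queue`).
Positivity of `g` makes `v` no dearer than `v ++ r`; hence `Q` is nonempty, and the popped signal,
being cheapest, obeys the bound.

Termination uses a weight on strings that pays for every step their expansion can cause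
(`Step.budget`). -/

theorem toSignal_append_left {R : ℕ} (hR : 0 < R) (v r : Str m) {t : ℝ} (ht : 0 ≤ t)
    (htv : t < (v.length : ℝ) / R) :
    (Str.toSignal R (v ++ r)).toFun t = (Str.toSignal R v).toFun t := by
  have hR' : (0 : ℝ) < R := by exact_mod_cast hR
  have h : ⌊t * R⌋₊ < v.length := by
    rw [Nat.floor_lt (by positivity)]
    rwa [lt_div_iff₀ hR'] at htv
  simp only [Str.toSignal, List.length_append]
  rw [show min ⌊t * R⌋₊ (v.length + r.length - 1) = ⌊t * R⌋₊ by omega,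
    show min ⌊t * R⌋₊ (v.length - 1) = ⌊t * R⌋₊ by omega, List.getD_append _ _ _ _ h]

theorem toSignal_append_right {R : ℕ} (hR : 0 < R) (v : Str m) {r : Str m} (hr : r ≠ []) {t : ℝ}
    (ht : 0 ≤ t) :
    (Str.toSignal R (v ++ r)).toFun (t + (v.length : ℝ) / R) = (Str.toSignal R r).toFun t := by
  have hR' : (0 : ℝ) < R := by exact_mod_cast hR
  have hl : 0 < r.length := List.length_pos_iff.2 hr
  have h : ⌊(t + (v.length : ℝ) / R) * R⌋₊ = ⌊t * R⌋₊ + v.length := by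
    rw [add_mul, div_mul_cancel₀ _ hR'.ne', Nat.floor_add_natCast (by positivity)]
  simp only [Str.toSignal, List.length_append]
  rw [h, show min (⌊t * R⌋₊ + v.length) (v.length + r.length - 1)
    = v.length + min ⌊t * R⌋₊ (r.length - 1) by omega, List.getD_append_right _ _ _ _ (by omega),
    Nat.add_sub_cancel_left]

theorem toSignal_mem {R : ℕ} {s : Str m} (hs : s ≠ []) (t : ℝ) :
    (Str.toSignal R s).toFun t ∈ s := by
  have hl : 0 < s.length := List.length_pos_iff.2 hs
  have h : min ⌊t * R⌋₊ (s.length - 1) < s.length := by omega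
  simp only [Str.toSignal]
  rw [List.getD_eq_getElem _ _ h]
  exact List.getElem_mem h

/-- Right continuity of the control is what turns the integral equation into an ODE for right
derivatives at every time, breakpoints included. -/
theorem toSignal_eventually_const {R : ℕ} (hR : 0 < R) (s : Str m) {t : ℝ} (ht : 0 ≤ t) :
    ∀ᶠ t' in 𝓝[≥] t, (Str.toSignal R s).toFun t' = (Str.toSignal R s).toFun t := by
  have hR' : (0 : ℝ) < R := by exact_mod_cast hR
  have h1 : t < ((⌊t * R⌋₊ : ℝ) + 1) / R := by
    rw [lt_div_iff₀ hR']
    exact Nat.lt_floor_add_one _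
  filter_upwards [self_mem_nhdsWithin, mem_nhdsWithin_of_mem_nhds (Iio_mem_nhds h1)] with t' h2 h3
  have h2' : t ≤ t' := h2
  have : ⌊t' * R⌋₊ = ⌊t * R⌋₊ := by
    rw [Nat.floor_eq_iff (mul_nonneg (ht.trans h2') hR'.le)]
    constructor
    · exact (Nat.floor_le (mul_nonneg ht hR'.le)).trans (by gcongr)
    · rwa [mem_Iio, lt_div_iff₀ hR'] at h3
  simp only [Str.toSignal, this]

theorem measurable_toSignal (R : ℕ) (s : Str m) : Measurable (Str.toSignal R s).toFun :=
  (measurable_of_countable fun k : ℕ => s.getD (min k (s.length - 1)) 0).comp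
    (Nat.measurable_floor.comp (measurable_id.mul_const (R : ℝ)))

theorem toSignal_mem_signals (hP : P.Admissible) {R : ℕ} (hR : 0 < R) {s : Str m} (hs : s ≠ [])
    (hsO : ∀ w ∈ s, w ∈ P.Omega) : Str.toSignal R s ∈ P.signals := by
  have hl : 0 < s.length := List.length_pos_iff.2 hs
  refine ⟨by simp only [Str.toSignal]; positivity, ?_, fun t _ => hsO _ (toSignal_mem hs t)⟩
  obtain ⟨C, hC⟩ := hP.isBounded_Omega.exists_norm_le
  exact Measure.integrableOn_of_bounded (by simp) (measurable_toSignal R s).aestronglyMeasurable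
    (M := C) (Eventually.of_forall fun t => hC _ (hsO _ (toSignal_mem hs t)))

/-! ### Flows -/

/-- `x` is a solution on `[0, T]` of `x' = f(x, u)`, in the sense of right derivatives. -/
structure IsFlow (P : ProblemData n m) (u : ℝ → Vec m) (T : ℝ) (x : ℝ → Vec n) : Prop where
  continuousOn : ContinuousOn x (Icc 0 T)
  hasDeriv : ∀ t ∈ Ico 0 T, HasDerivWithinAt x (P.f (x t) (u t)) (Ici t) t

theorem IsFlow.mono {u : ℝ → Vec m} {T T' : ℝ} {x : ℝ → Vec n} (h : IsFlow P u T x)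
    (hT : T' ≤ T) : IsFlow P u T' x :=
  ⟨h.1.mono (Icc_subset_Icc_right hT), fun t ht => h.2 t ⟨ht.1, ht.2.trans_le hT⟩⟩

theorem IsFlow.congr {u u' : ℝ → Vec m} {T : ℝ} {x : ℝ → Vec n} (h : IsFlow P u T x)
    (hu : ∀ t ∈ Ico 0 T, u t = u' t) : IsFlow P u' T x :=
  ⟨h.1, fun t ht => hu t ht ▸ h.2 t ht⟩

theorem hasDerivWithinAt_shift {x : ℝ → Vec n} {x' : Vec n} {t : ℝ} (a : ℝ)
    (h : HasDerivWithinAt x x' (Ici (t + a)) (t + a)) :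
    HasDerivWithinAt (fun s => x (s + a)) x' (Ici t) t := by
  have := HasDerivWithinAt.scomp (s := Ici t) (h := fun s => s + a) t h
    ((hasDerivWithinAt_id t _).add_const a) (fun s hs => by simpa using hs)
  simpa [Function.comp_def] using this

theorem IsFlow.shift {u : ℝ → Vec m} {a T : ℝ} {x : ℝ → Vec n} (h : IsFlow P u (T + a) x)
    (ha : 0 ≤ a) : IsFlow P (fun t => u (t + a)) T (fun t => x (t + a)) := by
  refine ⟨h.1.comp (by fun_prop) fun t ht => ⟨by linarith [ht.1], by linarith [ht.2]⟩, ?_⟩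
  exact fun t ht => hasDerivWithinAt_shift a (h.2 _ ⟨by linarith [ht.1], by linarith [ht.2]⟩)

/-- Only right derivatives are required, so a kink at the junction `a` is harmless; continuity there
is `hxy`. -/
theorem IsFlow.concat {u v : ℝ → Vec m} {a T : ℝ} {x y : ℝ → Vec n} (hx : IsFlow P u a x)
    (hy : IsFlow P v T y) (hxy : y 0 = x a) (ha : 0 ≤ a) (hT : 0 ≤ T) :
    IsFlow P (fun t => if t < a then u t else v (t - a)) (T + a)
      (fun t => if t < a then x t else y (t - a)) := by
  constructor
  · rw [← Icc_union_Icc_eq_Icc ha (by linarith : a ≤ T + a)]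
    refine ContinuousOn.union_of_isClosed ?_ ?_ isClosed_Icc isClosed_Icc
    · refine hx.1.congr fun t ht => ?_
      rcases ht.2.lt_or_eq with h | h
      · simp [h]
      · simp [h, hxy]
    · refine ContinuousOn.congr (f := fun t => y (t - a)) (hy.1.comp (by fun_prop) fun t ht =>
        ⟨by linarith [ht.1], by linarith [ht.2]⟩) fun t ht => ?_
      simp [not_lt.2 ht.1]
  · intro t ht
    by_cases h : t < a
    · simp only [h, if_true]
      refine (hx.2 t ⟨ht.1, h⟩).congr_of_eventuallyEq ?_ (by simp [h])
      filter_upwards [mem_nhdsWithin_of_mem_nhds (Iio_mem_nhds h)] with s hs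
      simp [mem_Iio.1 hs]
    · simp only [h, if_false]
      have := hasDerivWithinAt_shift (x := y) (t := t) (-a)
        (hy.2 (t + -a) ⟨by linarith, by linarith [ht.2]⟩)
      simp only [← sub_eq_add_neg] at this
      refine this.congr (fun s hs => ?_) (by simp [h])
      simp [not_lt.2 ((not_lt.1 h).trans hs)]

theorem ProblemData.Admissible.lipschitzWith_f (hP : P.Admissible) {w : Vec m}
    (hw : w ∈ P.Omega) : LipschitzWith P.Lf.toNNReal fun p => P.f p w :=
  LipschitzWith.of_dist_le_mul fun p q => by
    simpa [dist_eq_norm, hP.Lf_pos.le] using hP.f_lipschitz p q w hw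

/-- Grönwall's inequality; all stability and uniqueness statements below reduce to it. -/
theorem IsFlow.norm_sub_le (hP : P.Admissible) {u : ℝ → Vec m} {T : ℝ} {x y : ℝ → Vec n}
    (hu : ∀ t ∈ Ico 0 T, u t ∈ P.Omega) (hx : IsFlow P u T x) (hy : IsFlow P u T y) {e : ℝ}
    (he : ‖x 0 - y 0‖ ≤ e) {t : ℝ} (ht : t ∈ Icc 0 T) :
    ‖x t - y t‖ ≤ e * Real.exp (P.Lf * t) := by
  have := dist_le_of_trajectories_ODE_of_mem (v := fun t p => P.f p (u t)) (s := fun _ => univ)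
    (K := P.Lf.toNNReal) (δ := e) (fun t ht => (hP.lipschitzWith_f (hu t ht)).lipschitzOnWith)
    hx.1 hx.2 (fun _ _ => trivial) hy.1 hy.2 (fun _ _ => trivial) (by rwa [dist_eq_norm]) t ht
  simpa [dist_eq_norm, hP.Lf_pos.le] using this

/-- Picard–Lindelöf on a ball of radius `M * T`: the bound `M` on the speed keeps the solution
inside it up to time `T`, so existence is not merely local. -/
theorem exists_isFlow_const (hP : P.Admissible) {w : Vec m} (hw : w ∈ P.Omega) (p : Vec n) {T : ℝ}
    (hT : 0 ≤ T) : ∃ x, x 0 = p ∧ IsFlow P (fun _ => w) T x := by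
  have h : IsPicardLindelof (fun _ p => P.f p w) (tmin := 0) (tmax := T) ⟨0, le_rfl, hT⟩ p
      (P.M.toNNReal * T.toNNReal) 0 P.M.toNNReal P.Lf.toNNReal := by
    refine IsPicardLindelof.of_time_independent
      (fun x _ => (hP.f_bounded x w hw).trans (Real.le_coe_toNNReal _))
      (hP.lipschitzWith_f hw).lipschitzOnWith ?_
    simp [hT]
  obtain ⟨x, hx0, hx⟩ := h.exists_eq_forall_mem_Icc_hasDerivWithinAt₀
  refine ⟨x, hx0, fun t ht => (hx t ht).continuousWithinAt, fun t ht => ?_⟩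
  refine (hx t ⟨ht.1, ht.2.le⟩).mono_of_mem_nhdsWithin ?_
  exact mem_of_superset (Icc_mem_nhdsGE ht.2) (Icc_subset_Icc_left ht.1)

/-! ### Trajectories of strings -/

/-- `x` is a trajectory of the string `s` from the initial condition, on `[0, |s| / R]`. -/
structure IsTraj (P : ProblemData n m) (R : ℕ) (s : Str m) (x : ℝ → Vec n) : Prop where
  init : x 0 = P.xIC
  flow : IsFlow P (Str.toSignal R s).toFun ((s.length : ℝ) / R) x

theorem exists_isTraj (hP : P.Admissible) {R : ℕ} (hR : 0 < R) (s : Str m) :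
    (∀ w ∈ s, w ∈ P.Omega) → ∃ x, IsTraj P R s x := by
  have hR' : (0 : ℝ) < R := by exact_mod_cast hR
  induction s using List.reverseRecOn with
  | nil =>
    intro _
    refine ⟨fun _ => P.xIC, rfl, continuousOn_const, fun t ht => ?_⟩
    simp at ht
  | append_singleton s w ih =>
    intro hs
    obtain ⟨x, hx0, hx⟩ := ih fun v hv => hs v (by simp [hv])
    have hT : (0 : ℝ) ≤ 1 / R := by positivity
    obtain ⟨y, hy0, hy⟩ := exists_isFlow_const hP (hs w (by simp)) (x ((s.length : ℝ) / R)) hT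
    have h := hx.concat hy hy0 (by positivity) hT
    refine ⟨fun t => if t < (s.length : ℝ) / R then x t else y (t - (s.length : ℝ) / R), ?_, ?_⟩
    rotate_left
    · rw [show (((s ++ [w]).length : ℕ) : ℝ) / R = 1 / R + (s.length : ℝ) / R by
        push_cast [List.length_append, List.length_singleton]; ring]
      refine h.congr fun t ht => ?_
      by_cases hts : t < (s.length : ℝ) / R
      · simp only [hts, if_true]
        rw [toSignal_append_left hR s [w] ht.1 hts]
      · simp only [hts, if_false]
        have := toSignal_append_right hR s (r := [w]) (by simp) (t := t - (s.length : ℝ) / R)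
          (by linarith)
        rw [sub_add_cancel] at this
        rw [this]
        exact (List.mem_singleton.1 (toSignal_mem (R := R) (List.cons_ne_nil w []) _)).symm
    -- For empty `s` the value at time `0` comes from `y`, not from `x`.
    · rcases (show (0 : ℝ) ≤ (s.length : ℝ) / R by positivity).lt_or_eq with h0 | h0
      · simp [h0, hx0]
      · simp [← h0, hy0, hx0]

theorem IsTraj.eqOn (hP : P.Admissible) {R : ℕ} {s : Str m} (hs : ∀ w ∈ s, w ∈ P.Omega)
    {x y : ℝ → Vec n} (hx : IsTraj P R s x) (hy : IsTraj P R s y) :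
    EqOn x y (Icc 0 ((s.length : ℝ) / R)) := by
  intro t ht
  rcases eq_or_ne s [] with rfl | hne
  · have : t = 0 := by simpa using ht
    rw [this, hx.init, hy.init]
  · have := hx.flow.norm_sub_le hP (fun t _ => hs _ (toSignal_mem hne t)) hy.flow (e := 0)
      (by simp [hx.init, hy.init]) ht
    rw [zero_mul] at this
    exact sub_eq_zero.1 (norm_le_zero_iff.1 this)

theorem IsTraj.isSolution (hP : P.Admissible) {R : ℕ} (hR : 0 < R) {s : Str m} (hne : s ≠ [])
    (hs : ∀ w ∈ s, w ∈ P.Omega) {x : ℝ → Vec n} (hx : IsTraj P R s x) :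
    P.IsSolution P.xIC (Str.toSignal R s) ⟨(s.length : ℝ) / R, x⟩ := by
  set T : ℝ := (s.length : ℝ) / R with hT
  set F : ℝ → Vec n := fun t => P.f (x t) ((Str.toSignal R s).toFun t) with hF
  have hu : ∀ t, (Str.toSignal R s).toFun t ∈ P.Omega := fun t => hs _ (toSignal_mem hne t)
  have hsig := toSignal_mem_signals hP hR hne hs
  have hFM : ∀ t, ‖F t‖ ≤ P.M := fun t => hP.f_bounded _ _ (hu t)
  have hint : IntegrableOn F (Icc 0 T) volume := by
    -- Measurability of the integrand is read off from its being a right derivative of `x`.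
    have h1 : IntegrableOn (fun t => derivWithin x (Ici t) t) (Ico 0 T) volume := by
      refine Measure.integrableOn_of_bounded (by simp)
        (measurable_derivWithin_Ici x).aestronglyMeasurable (M := P.M) ?_
      refine (ae_restrict_iff' measurableSet_Ico).2 (Eventually.of_forall fun t ht => ?_)
      rw [(hx.flow.2 t ht).derivWithin (uniqueDiffWithinAt_Ici t)]
      exact hFM t
    rw [integrableOn_Icc_iff_integrableOn_Ico]
    refine h1.congr_fun (fun t ht => ?_) measurableSet_Ico
    exact (hx.flow.2 t ht).derivWithin (uniqueDiffWithinAt_Ici t)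
  have hsol : ∀ a b, 0 ≤ a → a ≤ b → b ≤ T → ∫ t in a..b, F t = x b - x a := by
    intro a b ha hab hb
    refine intervalIntegral.integral_eq_sub_of_hasDeriv_right_of_le hab
      (hx.flow.1.mono (Icc_subset_Icc ha hb)) (fun t ht => ?_) ?_
    · exact (hx.flow.2 t ⟨ha.trans ht.1.le, ht.2.trans_le hb⟩).mono Ioi_subset_Ici_self
    · rw [intervalIntegrable_iff_integrableOn_Icc_of_le hab]
      exact hint.mono_set (Icc_subset_Icc ha hb)
  refine ⟨hsig, ⟨hsig.1, hx.init, ?_⟩, rfl, hint, fun t ht => ?_⟩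
  · have key : ∀ a b, 0 ≤ a → a ≤ b → b ≤ T → ‖x b - x a‖ ≤ P.M * |b - a| := by
      intro a b ha hab hb
      rw [← hsol a b ha hab hb]
      exact intervalIntegral.norm_integral_le_of_norm_le_const fun t _ => hFM t
    intro a ha b hb
    rcases le_total a b with h | h
    · rw [norm_sub_rev, abs_sub_comm]
      exact key a b ha.1 h hb.2
    · exact key b a hb.1 h ha.2
  · rw [integral_Icc_eq_integral_Ioc, ← intervalIntegral.integral_of_le ht.1,
      hsol 0 t le_rfl ht.1 ht.2, hx.init]
    abel

theorem ProblemData.trajectories.continuousOn {x₀ : Vec n} {x : Timed n}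
    (hx : x ∈ P.trajectories x₀) : ContinuousOn x.toFun (Icc 0 x.τ) := by
  have : LipschitzOnWith P.M.toNNReal x.toFun (Icc 0 x.τ) := by
    refine LipschitzOnWith.of_dist_le_mul fun a ha b hb => ?_
    rw [dist_eq_norm, Real.dist_eq]
    exact (hx.2.2 a ha b hb).trans (by gcongr; exact Real.le_coe_toNNReal _)
  exact this.continuousOn

/-- The integrand is right continuous, as the control is constant just after `t`, so the fundamental
theorem of calculus gives the right derivative. -/
theorem isTraj_of_isSolution (hP : P.Admissible) {R : ℕ} (hR : 0 < R) {s : Str m} {x : Timed n}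
    (hx : P.IsSolution P.xIC (Str.toSignal R s) x) : IsTraj P R s x.toFun := by
  obtain ⟨⟨hτ, -, hu⟩, htr, hxτ, hint, hsol⟩ := hx
  have hc := ProblemData.trajectories.continuousOn htr
  rw [hxτ] at hc
  refine ⟨htr.2.1, hc, fun t ht => ?_⟩
  set T := (Str.toSignal R s).τ with hT
  change t ∈ Ico 0 T at ht
  set F : ℝ → Vec n := fun t => P.f (x.toFun t) ((Str.toSignal R s).toFun t) with hF
  have hIcc : Icc 0 T ∈ 𝓝[>] t :=
    mem_of_superset (Ioc_mem_nhdsGT ht.2) fun r hr => ⟨ht.1.trans hr.1.le, hr.2⟩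
  have hcont : ContinuousWithinAt F (Ioi t) t := by
    have hw := hu t ⟨ht.1, ht.2.le⟩
    have hf : Continuous fun p => P.f p ((Str.toSignal R s).toFun t) :=
      (hP.lipschitzWith_f hw).continuous
    have h1 : ContinuousWithinAt x.toFun (Ioi t) t :=
      (hc t ⟨ht.1, ht.2.le⟩).mono_of_mem_nhdsWithin hIcc
    refine (hf.continuousAt.comp_continuousWithinAt h1).congr_of_eventuallyEq ?_ rfl
    filter_upwards [nhdsWithin_mono t Ioi_subset_Ici_self
      (toSignal_eventually_const hR s ht.1)] with r hr
    simp [hF, hr]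
  have hii : IntervalIntegrable F volume 0 t := by
    rw [intervalIntegrable_iff_integrableOn_Icc_of_le ht.1]
    exact hint.mono_set (Icc_subset_Icc_right ht.2.le)
  have hd := (intervalIntegral.integral_hasDerivWithinAt_right hii (s := Ici t) (t := Ioi t)
    ⟨_, hIcc, hint.aestronglyMeasurable⟩ hcont).const_add P.xIC
  refine hd.congr_of_eventuallyEq ?_ ?_
  · filter_upwards [Icc_mem_nhdsGE ht.2] with r hr
    have hr' : r ∈ Icc 0 T := ⟨ht.1.trans hr.1, hr.2⟩
    rw [hsol r hr', integral_Icc_eq_integral_Ioc, ← intervalIntegral.integral_of_le hr'.1]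
  · rw [hsol t ⟨ht.1, ht.2.le⟩, integral_Icc_eq_integral_Ioc,
      ← intervalIntegral.integral_of_le ht.1]

/-- `sysMap` is an epsilon choice, so it has meaning only once a solution exists. Together with
`IsTraj.eqOn` this lets any trajectory of the string replace it. -/
theorem isTraj_sysMap (hP : P.Admissible) {R : ℕ} (hR : 0 < R) {s : Str m} (hne : s ≠ [])
    (hs : ∀ w ∈ s, w ∈ P.Omega) :
    IsTraj P R s (P.sysMap P.xIC (Str.toSignal R s)).toFun := by
  obtain ⟨x, hx⟩ := exists_isTraj hP hR s hs
  exact isTraj_of_isSolution hP hR (Classical.epsilon_spec ⟨_, hx.isSolution hP hR hne hs⟩)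

theorem IsTraj.of_append {R : ℕ} (hR : 0 < R) {v r : Str m} {x : ℝ → Vec n}
    (hx : IsTraj P R (v ++ r) x) : IsTraj P R v x := by
  refine ⟨hx.init, (hx.flow.mono ?_).congr fun t ht => toSignal_append_left hR v r ht.1 ht.2⟩
  gcongr
  simp

theorem length_append_div (R : ℕ) (v r : Str m) :
    ((v ++ r).length : ℝ) / R = (r.length : ℝ) / R + (v.length : ℝ) / R := by
  push_cast [List.length_append]
  ring

theorem IsTraj.flow_suffix {R : ℕ} (hR : 0 < R) {v r : Str m} {x : ℝ → Vec n}
    (hx : IsTraj P R (v ++ r) x) :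
    IsFlow P (Str.toSignal R r).toFun ((r.length : ℝ) / R)
      (fun t => x (t + (v.length : ℝ) / R)) := by
  have h := hx.flow
  rw [length_append_div] at h
  refine (h.shift (by positivity)).congr fun t ht => ?_
  rcases eq_or_ne r [] with rfl | hr
  · simp at ht
  · exact toSignal_append_right hR v hr ht.1

/-- Two trajectories that end with the same string of control values separate at an exponential
rate at most. -/
theorem IsTraj.norm_sub_le_suffix (hP : P.Admissible) {R : ℕ} (hR : 0 < R) {v w r : Str m}
    (hr : ∀ a ∈ r, a ∈ P.Omega) {x y : ℝ → Vec n} (hx : IsTraj P R (v ++ r) x)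
    (hy : IsTraj P R (w ++ r) y) {e : ℝ}
    (he : ‖x ((v.length : ℝ) / R) - y ((w.length : ℝ) / R)‖ ≤ e) {t : ℝ}
    (ht : t ∈ Icc 0 ((r.length : ℝ) / R)) :
    ‖x (t + (v.length : ℝ) / R) - y (t + (w.length : ℝ) / R)‖ ≤ e * Real.exp (P.Lf * t) := by
  refine (hx.flow_suffix hR).norm_sub_le hP (fun t ht => ?_) (hy.flow_suffix hR)
    (by simpa using he) ht
  rcases eq_or_ne r [] with rfl | hr'
  · simp at ht
  · exact hr _ (toSignal_mem hr' t)

/-! ### The cost of a string -/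

theorem IsTraj.strCost_eq (hP : P.Admissible) {A : Params m} (hR : 0 < A.R) {s : Str m}
    (hs : ∀ w ∈ s, w ∈ P.Omega) {x : ℝ → Vec n} (hx : IsTraj P A.R s x) :
    strCost P A s =
      ∫ t in (0 : ℝ)..(s.length : ℝ) / A.R, P.g (x t) ((Str.toSignal A.R s).toFun t) := by
  rw [intervalIntegral.integral_of_le (by positivity), ← integral_Icc_eq_integral_Ioc]
  rcases eq_or_ne s [] with rfl | hne
  · simp [strCost, ProblemData.cost, Str.toSignal]
  · refine setIntegral_congr_fun measurableSet_Icc fun t ht => ?_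
    simp only [((isTraj_sysMap hP hR hne hs).eqOn hP hs hx ht)]

/-- `g` is controlled only on `Xfree × Omega`, so it is first extended to a Lipschitz function on
the whole space; the composition is then measurable and bounded. -/
theorem integrableOn_runningCost (hP : P.Admissible) {u : ℝ → Vec m} {x : ℝ → Vec n} {T : ℝ}
    (hx : ContinuousOn x (Icc 0 T)) (hfree : ∀ t ∈ Icc 0 T, x t ∈ P.Xfree) (hu : Measurable u)
    (huO : ∀ t ∈ Icc 0 T, u t ∈ P.Omega) :
    IntegrableOn (fun t => P.g (x t) (u t)) (Icc 0 T) volume := by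
  -- The factor 2 passes from the sum of the two norms to the max distance of the product.
  have hlip : LipschitzOnWith (2 * P.Lg.toNNReal) (fun q : Vec n × Vec m => P.g q.1 q.2)
      (P.Xfree ×ˢ P.Omega) := by
    refine LipschitzOnWith.of_dist_le_mul fun p hp q hq => ?_
    have h := hP.g_lipschitz p.1 hp.1 q.1 hq.1 p.2 hp.2 q.2 hq.2
    have h1 : ‖p.1 - q.1‖ ≤ dist p q := by rw [← dist_eq_norm, Prod.dist_eq]; exact le_max_left _ _
    have h2 : ‖p.2 - q.2‖ ≤ dist p q := by rw [← dist_eq_norm, Prod.dist_eq]; exact le_max_right _ _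
    rw [Real.dist_eq]
    refine h.trans ?_
    simp only [NNReal.coe_mul, NNReal.coe_ofNat, Real.coe_toNNReal _ hP.Lg_nonneg]
    nlinarith [hP.Lg_nonneg]
  obtain ⟨G, hG, hGg⟩ := hlip.extend_real
  obtain ⟨C, hC⟩ := (isCompact_Icc.image_of_continuousOn hx).isBounded.exists_norm_le
  obtain ⟨D, hD⟩ := hP.isBounded_Omega.exists_norm_le
  have hbound : ∀ t ∈ Icc 0 T, ‖G (x t, u t)‖ ≤
      ‖G (0, 0)‖ + (2 * P.Lg.toNNReal : NNReal) * max C D := by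
    intro t ht
    have h := hG.dist_le_mul (x t, u t) (0, 0)
    rw [dist_eq_norm] at h
    have h1 : dist (x t, u t) (0, 0) ≤ max C D := by
      rw [Prod.dist_eq]
      simp only [dist_zero_right]
      exact max_le_max (hC _ (mem_image_of_mem x ht)) (hD _ (huO t ht))
    have h2 := norm_le_norm_add_norm_sub' (G (x t, u t)) (G (0, 0))
    have h3 := mul_le_mul_of_nonneg_left h1 (2 * P.Lg.toNNReal : NNReal).coe_nonneg
    linarith
  have hmeas : AEStronglyMeasurable (fun t => G (x t, u t)) (volume.restrict (Icc 0 T)) :=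
    hG.continuous.comp_aestronglyMeasurable
      ((hx.aestronglyMeasurable measurableSet_Icc).prodMk hu.aestronglyMeasurable)
  have : IntegrableOn (fun t => G (x t, u t)) (Icc 0 T) volume := by
    have : IsFiniteMeasure (volume.restrict (Icc 0 T)) := ⟨by simp⟩
    exact Integrable.of_bound hmeas _
      ((ae_restrict_iff' measurableSet_Icc).2 (Eventually.of_forall hbound))
  refine this.congr_fun (fun t ht => ?_) measurableSet_Icc
  exact (hGg (⟨hfree t ht, huO t ht⟩ : (x t, u t) ∈ P.Xfree ×ˢ P.Omega)).symm

theorem intervalIntegrable_suffix (hP : P.Admissible) {R : ℕ} (hR : 0 < R) {v r : Str m}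
    (hr : ∀ a ∈ r, a ∈ P.Omega) {x : ℝ → Vec n} (hx : IsTraj P R (v ++ r) x)
    (hfree : ∀ t ∈ Icc 0 (((v ++ r).length : ℝ) / R), x t ∈ P.Xfree) :
    IntervalIntegrable (fun t => P.g (x (t + (v.length : ℝ) / R)) ((Str.toSignal R r).toFun t))
      volume 0 ((r.length : ℝ) / R) := by
  rcases eq_or_ne r [] with rfl | hne
  · simp
  rw [intervalIntegrable_iff_integrableOn_Icc_of_le (by positivity)]
  refine integrableOn_runningCost hP (hx.flow_suffix hR).continuousOn (fun t ht => hfree _ ?_)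
    (measurable_toSignal R r) (fun t _ => hr _ (toSignal_mem hne t))
  rw [length_append_div]
  have : (0 : ℝ) ≤ (v.length : ℝ) / R := by positivity
  exact ⟨by linarith [ht.1], by linarith [ht.2]⟩

theorem IsTraj.strCost_append (hP : P.Admissible) {A : Params m} (hR : 0 < A.R) {v r : Str m}
    (hs : ∀ a ∈ v ++ r, a ∈ P.Omega) {x : ℝ → Vec n} (hx : IsTraj P A.R (v ++ r) x)
    (hfree : ∀ t ∈ Icc 0 (((v ++ r).length : ℝ) / A.R), x t ∈ P.Xfree) :
    strCost P A (v ++ r) = strCost P A v + ∫ t in (0 : ℝ)..(r.length : ℝ) / A.R,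
      P.g (x (t + (v.length : ℝ) / A.R)) ((Str.toSignal A.R r).toFun t) := by
  rcases eq_or_ne r [] with rfl | hne
  · simp
  have hv0 : (0 : ℝ) ≤ (v.length : ℝ) / A.R := by positivity
  have hr0 : (0 : ℝ) ≤ (r.length : ℝ) / A.R := by positivity
  have hint := intervalIntegrable_suffix hP hR (v := []) (r := v ++ r) hs hx hfree
  simp only [List.length_nil, Nat.cast_zero, zero_div, add_zero] at hint
  rw [hx.strCost_eq hP hR hs, (hx.of_append hR).strCost_eq hP hR fun a ha => hs a (by simp [ha])]
  rw [length_append_div] at hint ⊢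
  rw [intervalIntegrable_iff_integrableOn_Icc_of_le (by positivity)] at hint
  rw [← intervalIntegral.integral_add_adjacent_intervals (b := (v.length : ℝ) / A.R)]
  · congr 1
    -- The open interval matters: at its terminal time the signal of `v` keeps its last value, while
    -- that of `v ++ r` already takes the first value of `r`.
    · rw [intervalIntegral.integral_of_le hv0, intervalIntegral.integral_of_le hv0,
        integral_Ioc_eq_integral_Ioo, integral_Ioc_eq_integral_Ioo]
      refine setIntegral_congr_fun measurableSet_Ioo fun t ht => ?_
      simp only [toSignal_append_left hR v r ht.1.le ht.2]
    · have := intervalIntegral.integral_comp_add_right (a := 0) (b := (r.length : ℝ) / A.R)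
        (fun t => P.g (x t) ((Str.toSignal A.R (v ++ r)).toFun t)) ((v.length : ℝ) / A.R)
      rw [zero_add] at this
      rw [← this]
      refine intervalIntegral.integral_congr fun t ht => ?_
      rw [uIcc_of_le hr0] at ht
      simp only [toSignal_append_right hR v hne ht.1]
  · rw [intervalIntegrable_iff_integrableOn_Icc_of_le hv0]
    exact hint.mono_set (Icc_subset_Icc_right (by linarith))
  · rw [intervalIntegrable_iff_integrableOn_Icc_of_le (by linarith)]
    exact hint.mono_set (Icc_subset_Icc_left hv0)

theorem IsTraj.strCost_le_append (hP : P.Admissible) {A : Params m} (hR : 0 < A.R) {v r : Str m}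
    (hs : ∀ a ∈ v ++ r, a ∈ P.Omega) {x : ℝ → Vec n} (hx : IsTraj P A.R (v ++ r) x)
    (hfree : ∀ t ∈ Icc 0 (((v ++ r).length : ℝ) / A.R), x t ∈ P.Xfree) :
    strCost P A v ≤ strCost P A (v ++ r) := by
  rw [hx.strCost_append hP hR hs hfree, le_add_iff_nonneg_right]
  rcases eq_or_ne r [] with rfl | hne
  · simp
  refine intervalIntegral.integral_nonneg (by positivity) fun t ht => ?_
  refine (hP.g_pos _ (hfree _ ?_) _ (hs _ (by simp [toSignal_mem hne t]))).le
  rw [length_append_div]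
  have : (0 : ℝ) ≤ (v.length : ℝ) / A.R := by positivity
  exact ⟨by linarith [ht.1], by linarith [ht.2]⟩

/-- Replacing a prefix by a cheaper one with a nearby terminal state. -/
theorem IsTraj.strCost_append_le (hP : P.Admissible) {A : Params m} (hR : 0 < A.R)
    {v w r : Str m} (hv : ∀ a ∈ v ++ r, a ∈ P.Omega) (hw : ∀ a ∈ w ++ r, a ∈ P.Omega)
    {x y : ℝ → Vec n} (hx : IsTraj P A.R (v ++ r) x) (hy : IsTraj P A.R (w ++ r) y)
    (hxf : ∀ t ∈ Icc 0 (((v ++ r).length : ℝ) / A.R), x t ∈ P.Xfree)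
    (hyf : ∀ t ∈ Icc 0 (((w ++ r).length : ℝ) / A.R), y t ∈ P.Xfree) {e : ℝ}
    (he : ‖x ((v.length : ℝ) / A.R) - y ((w.length : ℝ) / A.R)‖ ≤ e)
    (hJ : strCost P A v ≤ strCost P A w) :
    strCost P A (v ++ r) ≤ strCost P A (w ++ r) +
      e * (P.Lg / P.Lf) * (Real.exp (P.Lf * ((r.length : ℝ) / A.R)) - 1) := by
  rcases eq_or_ne r [] with rfl | hne
  · simpa using hJ
  have hr : ∀ a ∈ r, a ∈ P.Omega := fun a ha => hv a (by simp [ha])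
  have hT : (0 : ℝ) ≤ (r.length : ℝ) / A.R := by positivity
  rw [hx.strCost_append hP hR hv hxf, hy.strCost_append hP hR hw hyf]
  set T := (r.length : ℝ) / A.R with hTdef
  have hexp : ∫ t in (0 : ℝ)..T, P.Lg * (e * Real.exp (P.Lf * t)) =
      e * (P.Lg / P.Lf) * (Real.exp (P.Lf * T) - 1) := by
    have h0 := hP.Lf_pos.ne'
    rw [intervalIntegral.integral_const_mul, intervalIntegral.integral_const_mul,
      intervalIntegral.integral_comp_mul_left (fun t => Real.exp t) h0, integral_exp]
    simp only [mul_zero, Real.exp_zero, smul_eq_mul]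
    field_simp
  have hie : IntervalIntegrable (fun t => P.Lg * (e * Real.exp (P.Lf * t))) volume 0 T :=
    Continuous.intervalIntegrable (by fun_prop) _ _
  have hiy := intervalIntegrable_suffix hP hR hr hy hyf
  -- Both strings apply the same control along `r`, so only the state difference enters the
  -- Lipschitz bound on `g`.
  have key := intervalIntegral.integral_mono_on hT (intervalIntegrable_suffix hP hR hr hx hxf)
    (hiy.add hie) (fun t ht => by
      have hmem : ∀ z : Str m, t + (z.length : ℝ) / A.R ∈
          Icc 0 (((z ++ r).length : ℝ) / A.R) := by
        intro z
        have : (0 : ℝ) ≤ (z.length : ℝ) / A.R := by positivity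
        rw [length_append_div]
        exact ⟨by linarith [ht.1], by linarith [ht.2]⟩
      have hu := hr _ (toSignal_mem (R := A.R) hne t)
      have h1 := hP.g_lipschitz _ (hxf _ (hmem v)) _ (hyf _ (hmem w)) _ hu _ hu
      rw [sub_self, norm_zero, add_zero] at h1
      have h2 := hx.norm_sub_le_suffix hP hR hr hy he ht
      have h3 := mul_le_mul_of_nonneg_left h2 hP.Lg_nonneg
      linarith [le_abs_self (P.g (x (t + (v.length : ℝ) / A.R)) ((Str.toSignal A.R r).toFun t) -
        P.g (y (t + (w.length : ℝ) / A.R)) ((Str.toSignal A.R r).toFun t))])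
  rw [intervalIntegral.integral_add hiy hie, hexp] at key
  linarith

/-! ### Admissible strings, goal strings and cells -/

theorem IsTraj.mem_freeSignals_iff (hP : P.Admissible) {R : ℕ} (hR : 0 < R) {s : Str m}
    (hne : s ≠ []) (hs : ∀ w ∈ s, w ∈ P.Omega) {x : ℝ → Vec n} (hx : IsTraj P R s x) :
    Str.toSignal R s ∈ P.freeSignals ↔ ∀ t ∈ Icc 0 ((s.length : ℝ) / R), x t ∈ P.Xfree := by
  constructor
  · rintro ⟨y, hy, hys⟩ t ht
    rw [hx.eqOn hP hs (isTraj_of_isSolution hP hR hys) ht]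
    exact hy.2 t (hys.2.2.1 ▸ ht)
  · intro h
    have hsol := hx.isSolution hP hR hne hs
    exact ⟨_, ⟨hsol.2.1, h⟩, hsol⟩

/-- Nonemptiness is essential: no signal has duration zero, so `sysMap` is arbitrary on the root. -/
theorem IsTraj.terminal_eq (hP : P.Admissible) {A : Params m} (hR : 0 < A.R) {s : Str m}
    (hne : s ≠ []) (hs : ∀ w ∈ s, w ∈ P.Omega) {x : ℝ → Vec n} (hx : IsTraj P A.R s x) :
    terminal P A s = x ((s.length : ℝ) / A.R) :=
  (isTraj_sysMap hP hR hne hs).eqOn hP hs hx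
    ⟨div_nonneg (Nat.cast_nonneg _) (Nat.cast_nonneg _), le_rfl⟩

/-- Ensures that the root is neither returned nor used as a dominating node. -/
theorem nil_notMem_freeSignals (R : ℕ) : Str.toSignal R ([] : Str m) ∉ P.freeSignals := by
  rintro ⟨x, -, hx⟩
  simpa [Str.toSignal] using hx.1.1

theorem goalSignals_subset_freeSignals : P.goalSignals ⊆ P.freeSignals :=
  fun _ ⟨x, hx, hs⟩ => ⟨x, hx.1, hs⟩

theorem SameCell.norm_terminal_sub_le {A : Params m} (hη : 0 < A.η) {s t : Str m}
    (h : SameCell P A s t) : ‖terminal P A s - terminal P A t‖ ≤ √n / A.η := by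
  have hi : ∀ i, ‖(terminal P A s - terminal P A t) i‖ ≤ 1 / A.η := by
    intro i
    have := Int.abs_sub_lt_one_of_floor_eq_floor (h i)
    rw [← mul_sub, abs_mul, abs_of_pos hη] at this
    rw [PiLp.sub_apply, Real.norm_eq_abs, le_div_iff₀ hη, mul_comm]
    exact this.le
  rw [EuclideanSpace.norm_eq, Real.sqrt_le_left (by positivity), div_pow, Real.sq_sqrt (by simp)]
  calc ∑ i, ‖(terminal P A s - terminal P A t) i‖ ^ 2 ≤ ∑ _i : Fin n, (1 / A.η) ^ 2 :=
        Finset.sum_le_sum fun i _ => by gcongr; exact hi i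
    _ = n / A.η ^ 2 := by simp [div_eq_mul_inv]

/-- The states that lie within `ε` of the terminal state of a trajectory in `𝒳_goal^ε` and that are
terminal states of trajectories themselves are goal states: prolong the given trajectory at
speed `M`. -/
theorem mem_Xgoal_of_goalInterior {x y : Timed n} {ε : ℝ}
    (hx : x ∈ P.goalInterior ε) (hy : y ∈ P.trajectories P.xIC)
    (h : ‖y.toFun y.τ - x.toFun x.τ‖ < ε) : y.toFun y.τ ∈ P.Xgoal := by
  obtain ⟨⟨hxT, -⟩, hball⟩ := hx
  obtain ⟨hxτ, hx0, hxL⟩ := hxT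
  set d := y.toFun y.τ - x.toFun x.τ with hd
  -- The sign of `M` is not assumed. For `M ≤ 0` no prolongation can move, but then all trajectories
  -- end at `xIC`.
  rcases le_or_gt P.M 0 with hM | hM
  · have hconst : ∀ z ∈ P.trajectories P.xIC, z.toFun z.τ = P.xIC := by
      intro z hz
      have h1 := hz.2.2 z.τ ⟨hz.1.le, le_rfl⟩ 0 ⟨le_rfl, hz.1.le⟩
      have h2 := mul_nonpos_of_nonpos_of_nonneg hM (abs_nonneg (z.τ - 0))
      rw [← hz.2.1]
      exact sub_eq_zero.1 (norm_le_zero_iff.1 (h1.trans h2))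
    have hmem : x ∈ P.trajBall x ε := by
      refine ⟨⟨hxτ, hx0, hxL⟩, ?_⟩
      have : P.trajDist x x ≤ 0 := by
        simp only [ProblemData.trajDist, sub_self, abs_zero, mul_zero, add_zero]
        exact Real.sSup_le (by rintro _ ⟨t, -, rfl⟩; simp) le_rfl
      exact this.trans_lt ((norm_nonneg d).trans_lt h)
    have := (hball hmem).2
    rwa [hconst y hy, ← hconst x ⟨hxτ, hx0, hxL⟩]
  -- `z` follows `x`, then runs straight to the endpoint of `y`. For `d = 0` the division by zero is
  -- harmless, since the added vector vanishes.
  · set z : Timed n := ⟨x.τ + ‖d‖ / P.M, fun t =>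
      x.toFun (min t x.τ) + (P.M / ‖d‖ * max (t - x.τ) 0) • d⟩ with hz
    have hdM : 0 ≤ ‖d‖ / P.M := by positivity
    have hzx : ∀ t ≤ x.τ, z.toFun t = x.toFun t := by
      intro t ht
      simp [hz, ht]
    have hzτ : z.toFun z.τ = y.toFun y.τ := by
      simp only [hz, add_sub_cancel_left, max_eq_left hdM]
      rw [min_eq_right (by linarith)]
      rcases eq_or_ne d 0 with h0 | h0
      · rw [h0, smul_zero, add_zero]
        exact (sub_eq_zero.1 h0).symm
      · have : ‖d‖ ≠ 0 := norm_ne_zero_iff.2 h0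
        rw [show P.M / ‖d‖ * (‖d‖ / P.M) = 1 by field_simp, one_smul, hd]
        abel
    have hzT : z ∈ P.trajectories P.xIC := by
      refine ⟨by simp only [hz]; positivity, by rw [hzx 0 hxτ.le, hx0], ?_⟩
      have key : ∀ s t, 0 ≤ s → s ≤ t → ‖z.toFun s - z.toFun t‖ ≤ P.M * |s - t| := by
        intro s t hs hst
        have h1 := hxL (min s x.τ) ⟨le_min hs hxτ.le, min_le_right _ _⟩ (min t x.τ)
          ⟨le_min (hs.trans hst) hxτ.le, min_le_right _ _⟩
        have h2 : ‖(P.M / ‖d‖ * max (s - x.τ) 0 - P.M / ‖d‖ * max (t - x.τ) 0) • d‖ ≤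
            P.M * |max (s - x.τ) 0 - max (t - x.τ) 0| := by
          rw [← mul_sub, norm_smul, norm_mul, Real.norm_eq_abs, Real.norm_eq_abs,
            abs_of_nonneg (by positivity : 0 ≤ P.M / ‖d‖), mul_right_comm]
          gcongr
          rcases eq_or_ne ‖d‖ 0 with h0 | h0
          · rw [h0, mul_zero]
            exact hM.le
          · rw [div_mul_cancel₀ _ h0]
        have h3 : |min s x.τ - min t x.τ| + |max (s - x.τ) 0 - max (t - x.τ) 0| = |s - t| := by
          rw [abs_of_nonpos (sub_nonpos.2 (min_le_min_right _ hst)),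
            abs_of_nonpos (sub_nonpos.2 (max_le_max_right _ (by linarith))),
            abs_of_nonpos (sub_nonpos.2 hst)]
          have hid : ∀ r : ℝ, min r x.τ + max (r - x.τ) 0 = r := by
            intro r
            rcases le_total r x.τ with hr | hr
            · rw [min_eq_left hr, max_eq_right (by linarith)]; ring
            · rw [min_eq_right hr, max_eq_left (by linarith)]; ring
          linarith [hid s, hid t]
        have h4 : z.toFun s - z.toFun t = (x.toFun (min s x.τ) - x.toFun (min t x.τ)) +
            (P.M / ‖d‖ * max (s - x.τ) 0 - P.M / ‖d‖ * max (t - x.τ) 0) • d := by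
          simp only [hz, sub_smul]
          abel
        rw [h4, ← h3, mul_add]
        exact (norm_add_le _ _).trans (add_le_add h1 h2)
      intro s hs t ht
      rcases le_total s t with hst | hst
      · exact key s t hs.1 hst
      · rw [norm_sub_rev, abs_sub_comm]
        exact key t s ht.1 hst
    have hzb : z ∈ P.trajBall x ε := by
      refine ⟨hzT, ?_⟩
      have h1 : sSup ((fun t => ‖x.toFun t - z.toFun t‖) '' Icc 0 (min x.τ z.τ)) ≤ 0 := by
        refine Real.sSup_le ?_ le_rfl
        rintro _ ⟨t, ht, rfl⟩
        simp [hzx t (ht.2.trans (min_le_left _ _))]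
      -- The extra duration is chosen so that the time term of the metric is exactly `‖d‖`; the
      -- supremum term is zero because `z` extends `x`.
      have h2 : P.M * |x.τ - z.τ| = ‖d‖ := by
        simp only [hz, sub_add_cancel_left, abs_neg, abs_of_nonneg hdM]
        field_simp
      rw [ProblemData.trajDist, h2]
      linarith
    rw [← hzτ]
    exact (hball hzb).2

/-! ### Termination -/

/-- A bound on the number of steps caused by a string that can be prolonged `j - 1` times, when
there are `k` control values. -/
def stepWeight (k : ℕ) : ℕ → ℕ
  | 0 => 0
  | j + 1 => k * (stepWeight k j + 1) + 2

/-- At most `N` steps remain to be done from the state. -/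
def Budget (A : Params m) : State m → ℕ → Prop
  | .head Q _, N => ∃ q : Finset (Str m), (q : Set (Str m)) = Q ∧ (∀ s ∈ q, s.length ≤ A.h) ∧
      ∑ s ∈ q, stepWeight A.W.card (A.h + 1 - s.length) + 1 ≤ N
  | .scan Q _ S todo, N => ∃ q s t : Finset (Str m), (q : Set (Str m)) = Q ∧
      (s : Set (Str m)) = S ∧ (t : Set (Str m)) = todo ∧ (∀ a ∈ q, a.length ≤ A.h) ∧
      (∀ a ∈ s, a ∉ t → a.length ≤ A.h) ∧
      ∑ a ∈ q, stepWeight A.W.card (A.h + 1 - a.length) +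
        ∑ a ∈ s, stepWeight A.W.card (A.h + 1 - a.length) + t.card + 2 ≤ N
  | .done _, _ => True

theorem budget_start (A : Params m) : Budget A (start m) (stepWeight A.W.card (A.h + 1) + 1) :=
  ⟨{[]}, by simp, by simp, by simp⟩

/-- Expanding a node trades its weight for those of its children, one unit per examination, and the
two steps entering and leaving the scan. Children at depth `h + 1` have weight `0`, as they can only
be pruned. -/
theorem Step.budget {st st' : State m} (h : Step P A st st') {N : ℕ} (hN : Budget A st N) :
    ∃ N' < N, Budget A st' N' := by
  classical
  cases h with
  | emptyQueue Λ =>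
    obtain ⟨q, -, -, h⟩ := hN
    exact ⟨0, by omega, trivial⟩
  | goal Q Λ u hu hg =>
    obtain ⟨q, -, -, h⟩ := hN
    exact ⟨0, by omega, trivial⟩
  | expand Q Λ u hu hg =>
    obtain ⟨q, rfl, hq, h⟩ := hN
    have huq : u ∈ q := hu.1
    set c : Finset (Str m) := A.W.image fun w => u ++ [w] with hc
    have hcard : c.card ≤ A.W.card := Finset.card_image_le
    have hcS : (c : Set (Str m)) = GLC.expand A u := by
      ext s
      simp [hc, GLC.expand, eq_comm]
    refine ⟨_, ?_, q.erase u, c, c, by simp, hcS, hcS, fun a ha => hq a (Finset.mem_of_mem_erase ha),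
      fun a h1 h2 => absurd h1 h2, le_rfl⟩
    have h1 := Finset.sum_erase_add q (fun s => stepWeight A.W.card (A.h + 1 - s.length)) huq
    have h2 : ∑ a ∈ c, stepWeight A.W.card (A.h + 1 - a.length) ≤
        A.W.card * stepWeight A.W.card (A.h - u.length) := by
      refine (Finset.sum_le_card_nsmul c _ (stepWeight A.W.card (A.h - u.length)) ?_).trans ?_
      · intro a ha
        obtain ⟨w, -, rfl⟩ := Finset.mem_image.1 ha
        simp
      · rw [smul_eq_mul]
        gcongr
    have h3 : stepWeight A.W.card (A.h + 1 - u.length) =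
        A.W.card * (stepWeight A.W.card (A.h - u.length) + 1) + 2 := by
      rw [show A.h + 1 - u.length = (A.h - u.length) + 1 by have := hq u huq; omega]
      rfl
    rw [mul_add, mul_one] at h3
    omega
  | prune Q Λ S todo w z hw hz hp =>
    obtain ⟨q, s, t, rfl, rfl, rfl, hq, hs, h⟩ := hN
    have hwt : w ∈ t := hw
    refine ⟨_, ?_, q, s.erase w, t.erase w, rfl, by simp, by simp, hq, fun a h1 h2 =>
      hs a (Finset.mem_of_mem_erase h1) fun h3 =>
        h2 (Finset.mem_erase.2 ⟨(Finset.mem_erase.1 h1).1, h3⟩), le_rfl⟩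
    have h1 := Finset.card_erase_add_one hwt
    have h2 : ∑ a ∈ s.erase w, stepWeight A.W.card (A.h + 1 - a.length) ≤
        ∑ a ∈ s, stepWeight A.W.card (A.h + 1 - a.length) :=
      Finset.sum_le_sum_of_subset (Finset.erase_subset _ _)
    omega
  | relabel Q Λ S todo w z hw hz hp hc =>
    obtain ⟨q, s, t, rfl, rfl, rfl, hq, hs, h⟩ := hN
    have hwt : w ∈ t := hw
    have hlen : w.length ≤ A.h := not_lt.1 fun hl => hp (Or.inr (Or.inr hl))
    refine ⟨_, ?_, q, s, t.erase w, rfl, rfl, by simp, hq, fun a h1 h2 => ?_, le_rfl⟩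
    · have h1 := Finset.card_erase_add_one hwt
      omega
    · rcases eq_or_ne a w with rfl | haw
      · exact hlen
      · exact hs a h1 fun h3 => h2 (Finset.mem_erase.2 ⟨haw, h3⟩)
  | keep Q Λ S todo w z hw hz hp hc =>
    obtain ⟨q, s, t, rfl, rfl, rfl, hq, hs, h⟩ := hN
    have hwt : w ∈ t := hw
    have hlen : w.length ≤ A.h := not_lt.1 fun hl => hp (Or.inr (Or.inr hl))
    refine ⟨_, ?_, q, s, t.erase w, rfl, rfl, by simp, hq, fun a h1 h2 => ?_, le_rfl⟩
    · have h1 := Finset.card_erase_add_one hwt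
      omega
    · rcases eq_or_ne a w with rfl | haw
      · exact hlen
      · exact hs a h1 fun h3 => h2 (Finset.mem_erase.2 ⟨haw, h3⟩)
  | enqueue Q Λ S =>
    obtain ⟨q, s, t, rfl, rfl, ht, hq, hs, h⟩ := hN
    obtain rfl : t = ∅ := by simpa using ht
    refine ⟨_, ?_, q ∪ s, by simp, fun a ha => ?_, le_rfl⟩
    -- `Q` and `S` are not known to be disjoint; an overlap only lowers the sum.
    · have := Finset.sum_union_inter (s₁ := q) (s₂ := s)
        (f := fun s => stepWeight A.W.card (A.h + 1 - s.length))
      omega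
    · rcases Finset.mem_union.1 ha with ha | ha
      · exact hq a ha
      · exact hs a ha (by simp)

theorem length_run_le {k : ℕ} {run : ℕ → State m} (h0 : run 0 = start m)
    (hrun : ∀ i < k, Step P A (run i) (run (i + 1))) :
    k ≤ stepWeight A.W.card (A.h + 1) + 1 := by
  have key : ∀ i ≤ k, ∃ N, Budget A (run i) N ∧ N + i ≤ stepWeight A.W.card (A.h + 1) + 1 := by
    intro i
    induction i with
    | zero => exact fun _ => ⟨_, h0 ▸ budget_start A, le_rfl⟩
    | succ i ih =>
      intro hi
      obtain ⟨N, hN, hNi⟩ := ih (by omega)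
      obtain ⟨N', hN', hb⟩ := (hrun i (by omega)).budget hN
      exact ⟨N', hb, by omega⟩
  obtain ⟨N, -, h⟩ := key k le_rfl
  omega

theorem exists_budget_of_reachable {st : State m}
    (h : Relation.ReflTransGen (Step P A) (start m) st) : ∃ N, Budget A st N := by
  induction h with
  | refl => exact ⟨_, budget_start A⟩
  | tail _ hs ih =>
    obtain ⟨N, hN⟩ := ih
    obtain ⟨N', -, h⟩ := hs.budget hN
    exact ⟨N', h⟩

theorem done_or_exists_step {st : State m} {N : ℕ} (hN : Budget A st N) :
    (∃ out, st = State.done out) ∨ ∃ st', Step P A st st' := by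
  cases st with
  | done out => exact Or.inl ⟨out, rfl⟩
  | head Q Λ =>
    right
    obtain ⟨q, rfl, -, -⟩ := hN
    rcases q.eq_empty_or_nonempty with rfl | hne
    · exact ⟨_, by simpa using Step.emptyQueue Λ⟩
    · obtain ⟨u, hu, hmin⟩ := q.exists_min_image (strCost P A) hne
      by_cases hg : Str.toSignal A.R u ∈ P.goalSignals
      · exact ⟨_, Step.goal _ Λ u ⟨hu, hmin⟩ hg⟩
      · exact ⟨_, Step.expand _ Λ u ⟨hu, hmin⟩ hg⟩
  | scan Q Λ S todo =>
    right
    rcases todo.eq_empty_or_nonempty with rfl | ⟨w, hw⟩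
    · exact ⟨_, Step.enqueue Q Λ S⟩
    · obtain ⟨z, hz⟩ : ∃ z, IsFind P A Λ w z := by
        by_cases h : ∃ z ∈ Λ, SameCell P A w z
        · obtain ⟨z, hz⟩ := h
          exact ⟨some z, hz⟩
        · exact ⟨none, fun z hz hzw => h ⟨z, hz, hzw⟩⟩
      by_cases hp : Pruned P A w z
      · exact ⟨_, Step.prune Q Λ S todo w z hw hz hp⟩
      · by_cases hc : (strCost P A w : EReal) < optCost P A z
        · exact ⟨_, Step.relabel Q Λ S todo w z hw hz hp hc⟩
        · exact ⟨_, Step.keep Q Λ S todo w z hw hz hp hc⟩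

/-! ### The invariant -/

/-- The child `w` has entered the search tree `G`, or was discarded for a good reason. -/
def Settled (P : ProblemData n m) (A : Params m) (G : Set (Str m)) (w : Str m) : Prop :=
  w ∈ G ∨ Str.toSignal A.R w ∉ P.freeSignals ∨ A.h < w.length ∨
    ∃ z ∈ G, Str.toSignal A.R z ∈ P.freeSignals ∧ Prec P A z w

theorem Settled.mono {G G' : Set (Str m)} {w : Str m} (h : Settled P A G w) (hG : G ⊆ G') :
    Settled P A G' w := by
  rcases h with h | h | h | ⟨z, hz, h⟩
  · exact Or.inl (hG h)
  · exact Or.inr (Or.inl h)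
  · exact Or.inr (Or.inr (Or.inl h))
  · exact Or.inr (Or.inr (Or.inr ⟨z, hG hz, h⟩))

/-- The invariant for the search tree `G`, its expanded part `E`, the labels `Λ`, and the children
`todo` that are still to be examined. -/
structure IsSearchTree (P : ProblemData n m) (A : Params m) (G E Λ todo : Set (Str m)) : Prop where
  root_mem : [] ∈ G
  mem_tree : ∀ s ∈ G, s = [] ∨ s ∈ stringSignals A ∧ Str.toSignal A.R s ∈ P.freeSignals
  labels : ∀ s ∈ Λ, s ∈ G ∧ Str.toSignal A.R s ∈ P.freeSignals
  not_goal : ∀ u ∈ E, Str.toSignal A.R u ∉ P.goalSignals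
  settled : ∀ u ∈ E, ∀ a ∈ A.W, u ++ [a] ∈ todo ∨ Settled P A G (u ++ [a])
  mem_todo : ∀ s ∈ todo, s ≠ [] ∧ ∀ w ∈ s, w ∈ A.W

/-- The invariant of the algorithm. -/
def Invariant (P : ProblemData n m) (A : Params m) : State m → Prop
  | .head Q Λ => ∃ E, IsSearchTree P A (Q ∪ E) E Λ ∅
  | .scan Q Λ S todo => todo ⊆ S ∧ ∃ E, IsSearchTree P A (Q ∪ E ∪ (S \ todo)) E Λ todo
  | .done out => ∃ Q Λ E, IsSearchTree P A (Q ∪ E) E Λ ∅ ∧ (Q = ∅ ∧ out = (⊤, none) ∨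
      ∃ u, IsPop P A Q u ∧ Str.toSignal A.R u ∈ P.goalSignals ∧
        out = ((strCost P A u : EReal), some u))

theorem invariant_start (P : ProblemData n m) (A : Params m) : Invariant P A (start m) :=
  ⟨∅, by simp, by simp, by simp, by simp, by simp, by simp⟩

/-- The dominating label is recorded as a member of the tree `G`, which never shrinks. Hence its
later removal from `Λ` does no harm. -/
theorem IsSearchTree.prune {G E Λ todo : Set (Str m)} (h : IsSearchTree P A G E Λ todo)
    {w : Str m} {z : Option (Str m)} (hz : IsFind P A Λ w z) (hp : Pruned P A w z) :
    IsSearchTree P A G E Λ (todo \ {w}) := by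
  refine ⟨h.root_mem, h.mem_tree, h.labels, h.not_goal, fun u hu a ha => ?_,
    fun s hs => h.mem_todo s hs.1⟩
  by_cases hw : u ++ [a] = w
  · right
    rw [hw]
    rcases hp with hp | ⟨s, rfl, hp⟩ | hp
    · exact Or.inr (Or.inl hp)
    · exact Or.inr (Or.inr (Or.inr ⟨s, (h.labels s hz.1).1, (h.labels s hz.1).2, hp⟩))
    · exact Or.inr (Or.inr (Or.inl hp))
  · exact (h.settled u hu a ha).imp_left fun h => ⟨h, hw⟩

theorem IsSearchTree.accept {G E Λ Λ' todo : Set (Str m)} (h : IsSearchTree P A G E Λ todo)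
    {w : Str m} {z : Option (Str m)} (hw : w ∈ todo) (hp : ¬ Pruned P A w z)
    (hΛ : Λ' ⊆ Λ ∪ {w}) : IsSearchTree P A (G ∪ {w}) E Λ' (todo \ {w}) := by
  have hfree : Str.toSignal A.R w ∈ P.freeSignals := not_not.1 fun h => hp (Or.inl h)
  have hlen : w.length ≤ A.h := not_lt.1 fun hl => hp (Or.inr (Or.inr hl))
  obtain ⟨hne, hW⟩ := h.mem_todo w hw
  refine ⟨Or.inl h.root_mem, ?_, ?_, h.not_goal, fun u hu a ha => ?_,
    fun s hs => h.mem_todo s hs.1⟩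
  · rintro s (hs | rfl)
    · exact h.mem_tree s hs
    · exact Or.inr ⟨⟨hne, hlen, hW⟩, hfree⟩
  · intro s hs
    rcases hΛ hs with hs | rfl
    · exact ⟨Or.inl (h.labels s hs).1, (h.labels s hs).2⟩
    · exact ⟨Or.inr rfl, hfree⟩
  · by_cases huw : u ++ [a] = w
    · exact Or.inr (Or.inl (Or.inr huw))
    · exact (h.settled u hu a ha).imp (fun h => ⟨h, huw⟩) fun h => h.mono subset_union_left

theorem sdiff_sdiff_singleton_eq {S todo : Set (Str m)} {w : Str m} (hw : w ∈ todo)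
    (hS : todo ⊆ S) : S \ (todo \ {w}) = S \ todo ∪ {w} := by
  ext s
  by_cases h : s = w
  · simp [h, hS hw]
  · simp [h]

theorem Step.invariant {st st' : State m} (h : Step P A st st') (hI : Invariant P A st) :
    Invariant P A st' := by
  cases h with
  | emptyQueue Λ =>
    obtain ⟨E, hE⟩ := hI
    exact ⟨∅, Λ, E, hE, Or.inl ⟨rfl, rfl⟩⟩
  | goal Q Λ u hu hg =>
    obtain ⟨E, hE⟩ := hI
    exact ⟨Q, Λ, E, hE, Or.inr ⟨u, hu, hg, rfl⟩⟩
  | expand Q Λ u hu hg =>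
    obtain ⟨E, hE⟩ := hI
    refine ⟨subset_rfl, E ∪ {u}, ?_⟩
    -- Popping moves `u` from the queue to the expanded part, and no child is accepted yet, so the
    -- tree is unchanged.
    have hG : Q \ {u} ∪ (E ∪ {u}) ∪ (GLC.expand A u \ GLC.expand A u) = Q ∪ E := by
      ext s
      by_cases h : s = u
      · simp [h, hu.1]
      · simp [h]
    rw [hG]
    refine ⟨hE.root_mem, hE.mem_tree, hE.labels, ?_, ?_, ?_⟩
    · rintro v (hv | rfl)
      · exact hE.not_goal v hv
      · exact hg
    · rintro v (hv | rfl) a ha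
      · exact (hE.settled v hv a ha).imp_left fun h => h.elim
      · exact Or.inl ⟨a, ha, rfl⟩
    · rintro _ ⟨a, ha, rfl⟩
      refine ⟨by simp, fun w hw => ?_⟩
      rcases List.mem_append.1 hw with hw | hw
      · rcases hE.mem_tree u (Or.inl hu.1) with rfl | h
        · simp at hw
        · exact h.1.2.2 w hw
      · rwa [List.mem_singleton.1 hw]
  | prune Q Λ S todo w z hw hz hp =>
    obtain ⟨hS, E, hE⟩ := hI
    refine ⟨sdiff_subset_sdiff_left hS, E, ?_⟩
    have : (S \ {w}) \ (todo \ {w}) = S \ todo := by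
      ext s
      by_cases h : s = w
      · simp [h, hw]
      · simp [h]
    rw [this]
    exact hE.prune hz hp
  | relabel Q Λ S todo w z hw hz hp hc =>
    obtain ⟨hS, E, hE⟩ := hI
    refine ⟨sdiff_subset.trans hS, E, ?_⟩
    rw [sdiff_sdiff_singleton_eq hw hS, ← union_assoc]
    exact hE.accept hw hp (union_subset_union_left _ sdiff_subset)
  | keep Q Λ S todo w z hw hz hp hc =>
    obtain ⟨hS, E, hE⟩ := hI
    refine ⟨sdiff_subset.trans hS, E, ?_⟩
    rw [sdiff_sdiff_singleton_eq hw hS, ← union_assoc]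
    exact hE.accept hw hp subset_union_left
  | enqueue Q Λ S =>
    obtain ⟨-, E, hE⟩ := hI
    rw [sdiff_empty, union_right_comm] at hE
    exact ⟨E, hE⟩

theorem invariant_of_reachable {st : State m}
    (h : Relation.ReflTransGen (Step P A) (start m) st) : Invariant P A st := by
  induction h with
  | refl => exact invariant_start P A
  | tail _ hs ih => exact hs.invariant ih

/-! ### Near-optimal prolongations of nodes of the search tree -/

/-- The string `v ++ r` is admissible, its cost exceeds that of `u` by `C` at most, and it follows
the trajectory `x₀` of `u` up to `D` while it executes the common suffix `r`. -/
structure NearOptimal (P : ProblemData n m) (A : Params m) (u : Str m) (x₀ : ℝ → Vec n)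
    (v r : Str m) (D C : ℝ) : Prop where
  ne_nil : v ++ r ≠ []
  mem_W : ∀ a ∈ v ++ r, a ∈ A.W
  length_le : (v ++ r).length ≤ A.h
  exists_traj : ∃ p x, u = p ++ r ∧ IsTraj P A.R (v ++ r) x ∧
    (∀ t ∈ Icc 0 (((v ++ r).length : ℝ) / A.R), x t ∈ P.Xfree) ∧
    ∀ t ∈ Icc 0 ((r.length : ℝ) / A.R),
      ‖x (t + (v.length : ℝ) / A.R) - x₀ (t + (p.length : ℝ) / A.R)‖ ≤ D
  cost_le : strCost P A (v ++ r) ≤ strCost P A u + C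

variable {u v w z r : Str m} {x₀ : ℝ → Vec n} {D D' C C' ε : ℝ}

theorem NearOptimal.mono (h : NearOptimal P A u x₀ v r D C) (hD : D ≤ D') (hC : C ≤ C') :
    NearOptimal P A u x₀ v r D' C' := by
  obtain ⟨h1, h2, h3, ⟨p, x, h4, h5, h6, h7⟩, h8⟩ := h
  exact ⟨h1, h2, h3, ⟨p, x, h4, h5, h6, fun t ht => (h7 t ht).trans hD⟩, h8.trans (by gcongr)⟩

/-- The full string stays the same; only the window on which the deviation is measured shrinks by
one letter. -/
theorem NearOptimal.advance {a : Vec m} (h : NearOptimal P A u x₀ v (a :: r) D C) :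
    NearOptimal P A u x₀ (v ++ [a]) r D C := by
  obtain ⟨h1, h2, h3, ⟨p, x, h4, h5, h6, h7⟩, h8⟩ := h
  have hv : v ++ a :: r = v ++ [a] ++ r := by simp
  rw [hv] at h1 h2 h3 h5 h6 h8
  refine ⟨h1, h2, h3, ⟨p ++ [a], x, by simp [h4], h5, h6, fun t ht => ?_⟩, h8⟩
  have h := h7 (t + 1 / A.R) ⟨add_nonneg ht.1 (by positivity), ?_⟩
  · convert h using 4 <;> (push_cast [List.length_append, List.length_singleton]; ring)
  · have := ht.2
    push_cast [List.length_cons]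
    rw [add_div]
    linarith

/-- Passing to a string that dominates `w` in the sense of `≺_R`. -/
theorem NearOptimal.replace (hP : P.Admissible) (hR : 0 < A.R) (hη : 0 < A.η)
    (hW : (A.W : Set (Vec m)) ⊆ P.Omega)
    (hball : ∀ t ∈ Icc 0 ((u.length : ℝ) / A.R), Metric.ball (x₀ t) ε ⊆ P.Xfree)
    (h : NearOptimal P A u x₀ w r D C) (hw : w ≠ []) (hz : z ≠ []) (hzW : ∀ a ∈ z, a ∈ A.W)
    (hzfree : Str.toSignal A.R z ∈ P.freeSignals) (hzw : Prec P A z w)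
    (hε : √n / A.η * Real.exp (P.Lf * ((r.length : ℝ) / A.R)) + D < ε) :
    NearOptimal P A u x₀ z r (√n / A.η * Real.exp (P.Lf * ((r.length : ℝ) / A.R)) + D)
      (√n / A.η * (P.Lg / P.Lf) * (Real.exp (P.Lf * ((r.length : ℝ) / A.R)) - 1) + C) := by
  obtain ⟨h1, h2, h3, ⟨p, x, h4, h5, h6, h7⟩, h8⟩ := h
  have hR' : (0 : ℝ) < A.R := by exact_mod_cast hR
  obtain ⟨hcell, hτ, hJ⟩ := hzw
  -- The duration clause of `≺_R` keeps the new string within the depth limit.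
  have hlen : z.length ≤ w.length := by
    simp only [Str.toSignal] at hτ
    rw [div_le_div_iff_of_pos_right hR'] at hτ
    exact_mod_cast hτ
  have hzrW : ∀ a ∈ z ++ r, a ∈ A.W := fun a ha => (List.mem_append.1 ha).elim (hzW a) fun ha =>
    h2 a (List.mem_append_right w ha)
  have hzrO : ∀ a ∈ z ++ r, a ∈ P.Omega := fun a ha => hW (hzrW a ha)
  have hwrO : ∀ a ∈ w ++ r, a ∈ P.Omega := fun a ha => hW (h2 a ha)
  have hzO : ∀ a ∈ z, a ∈ P.Omega := fun a ha => hW (hzW a ha)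
  have hwO : ∀ a ∈ w, a ∈ P.Omega := fun a ha => hwrO a (List.mem_append_left r ha)
  obtain ⟨y, hy⟩ := exists_isTraj hP hR (z ++ r) hzrO
  have he : ‖y ((z.length : ℝ) / A.R) - x ((w.length : ℝ) / A.R)‖ ≤ √n / A.η := by
    rw [← (hy.of_append hR).terminal_eq hP hR hz hzO, ← (h5.of_append hR).terminal_eq hP hR hw hwO]
    exact hcell.norm_terminal_sub_le hη
  have hdev : ∀ t ∈ Icc 0 ((r.length : ℝ) / A.R),
      ‖y (t + (z.length : ℝ) / A.R) - x₀ (t + (p.length : ℝ) / A.R)‖ ≤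
        √n / A.η * Real.exp (P.Lf * ((r.length : ℝ) / A.R)) + D := by
    intro t ht
    have hd := hy.norm_sub_le_suffix hP hR (fun a ha => hzrO a (List.mem_append_right z ha)) h5
      he ht
    have hexp : Real.exp (P.Lf * t) ≤ Real.exp (P.Lf * ((r.length : ℝ) / A.R)) :=
      Real.exp_le_exp.2 (mul_le_mul_of_nonneg_left ht.2 hP.Lf_pos.le)
    have hd' := mul_le_mul_of_nonneg_left hexp (by positivity : 0 ≤ √n / A.η)
    exact (norm_sub_le_norm_sub_add_norm_sub _ _ _).trans (add_le_add (hd.trans hd') (h7 t ht))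
  -- Along `z` the trajectory is free because `z` is; it need not be near `x₀` there. Along `r` it
  -- stays in the `ε`-balls about `x₀`.
  have hyfree : ∀ t ∈ Icc 0 (((z ++ r).length : ℝ) / A.R), y t ∈ P.Xfree := by
    intro t ht
    rw [length_append_div] at ht
    rcases le_total t ((z.length : ℝ) / A.R) with htz | htz
    · exact ((hy.of_append hR).mem_freeSignals_iff hP hR hz hzO).1 hzfree t ⟨ht.1, htz⟩
    · have ht' : t - (z.length : ℝ) / A.R ∈ Icc 0 ((r.length : ℝ) / A.R) :=
        ⟨by linarith, by linarith [ht.2]⟩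
      have hp0 : (0 : ℝ) ≤ (p.length : ℝ) / A.R := by positivity
      have hd := (hdev _ ht').trans_lt hε
      rw [sub_add_cancel, ← dist_eq_norm] at hd
      refine hball _ ?_ hd
      rw [h4, length_append_div]
      exact ⟨by linarith [ht'.1], by linarith [ht'.2]⟩
  refine ⟨by simp [hz], hzrW, ?_, ⟨p, y, h4, hy, hyfree, hdev⟩, ?_⟩
  · rw [List.length_append] at h3 ⊢
    omega
  · have := hy.strCost_append_le hP hR hzrO hwrO h5 hyfree h6 he hJ
    linarith

theorem NearOptimal.mem_freeSignals (hP : P.Admissible) (hR : 0 < A.R)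
    (hW : (A.W : Set (Vec m)) ⊆ P.Omega) (h : NearOptimal P A u x₀ v r D C) (hv : v ≠ []) :
    Str.toSignal A.R v ∈ P.freeSignals := by
  obtain ⟨h1, h2, h3, ⟨p, x, h4, h5, h6, h7⟩, h8⟩ := h
  rw [(h5.of_append hR).mem_freeSignals_iff hP hR hv
    fun a ha => hW (h2 a (List.mem_append_left r ha))]
  refine fun t ht => h6 t ⟨ht.1, ht.2.trans ?_⟩
  gcongr
  simp

theorem NearOptimal.strCost_le (hP : P.Admissible) (hR : 0 < A.R)
    (hW : (A.W : Set (Vec m)) ⊆ P.Omega) (h : NearOptimal P A u x₀ v r D C) :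
    strCost P A v ≤ strCost P A u + C := by
  obtain ⟨h1, h2, h3, ⟨p, x, h4, h5, h6, h7⟩, h8⟩ := h
  exact (h5.strCost_le_append hP hR (fun a ha => hW (h2 a ha)) h6).trans h8

theorem NearOptimal.mem_goalSignals (hP : P.Admissible) (hR : 0 < A.R)
    (hW : (A.W : Set (Vec m)) ⊆ P.Omega) {x : Timed n} (hx : x ∈ P.goalInterior ε)
    (hxu : P.IsSolution P.xIC (Str.toSignal A.R u) x)
    (h : NearOptimal P A u x.toFun v [] D C) (hD : D < ε) :
    Str.toSignal A.R v ∈ P.goalSignals := by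
  obtain ⟨h1, h2, h3, ⟨p, y, h4, h5, h6, h7⟩, h8⟩ := h
  simp only [List.append_nil] at h1 h2 h3 h4 h5 h6 h8
  subst h4
  have hsol := h5.isSolution hP hR h1 fun a ha => hW (h2 a ha)
  refine ⟨_, ⟨⟨hsol.2.1, h6⟩, mem_Xgoal_of_goalInterior hx hsol.2.1 ?_⟩, hsol⟩
  -- With no suffix left, the deviation at `t = 0` compares the two terminal states, although the
  -- durations may differ.
  have := h7 0 (by simp)
  rw [zero_add, zero_add] at this
  rw [hxu.2.2.1]
  exact this.trans_lt hD

/-! ### The sums `δ_h` and `γ_h` -/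

/-- Reindexed so that `l` counts the control values still to be applied. -/
theorem deltaSum_eq (P : ProblemData n m) (A : Params m) :
    deltaSum P A A.h = ∑ l ∈ Finset.range (A.h + 1),
      √n / A.η * Real.exp (P.Lf * ((l : ℝ) / A.R)) := by
  rw [deltaSum, ← Finset.sum_range_reflect]
  refine Finset.sum_congr rfl fun i hi => ?_
  rw [show A.h + 1 - 1 - i = A.h - i by omega,
    Nat.cast_sub (Nat.lt_succ_iff.1 (Finset.mem_range.1 hi)), sub_sub_cancel]

theorem gammaSum_eq (P : ProblemData n m) (A : Params m) :
    gammaSum P A A.h = ∑ l ∈ Finset.range (A.h + 1),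
      √n / A.η * (P.Lg / P.Lf) * (Real.exp (P.Lf * ((l : ℝ) / A.R)) - 1) := by
  rw [gammaSum, ← Finset.sum_range_reflect]
  refine Finset.sum_congr rfl fun i hi => ?_
  rw [show A.h + 1 - 1 - i = A.h - i by omega,
    Nat.cast_sub (Nat.lt_succ_iff.1 (Finset.mem_range.1 hi)), sub_sub_cancel]

/-- The omitted term `l = h` is positive because `n > 0`; strictness is needed as the balls are
open. -/
theorem sum_Ico_lt_deltaSum (hn : 0 < n) (P : ProblemData n m) (hη : 0 < A.η) (j : ℕ) :
    ∑ l ∈ Finset.Ico j A.h, √n / A.η * Real.exp (P.Lf * ((l : ℝ) / A.R)) <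
      deltaSum P A A.h := by
  rw [deltaSum_eq]
  refine Finset.sum_lt_sum_of_subset (i := A.h) (fun l hl => ?_) (by simp) (by simp)
    (by positivity) fun l _ _ => by positivity
  have := (Finset.mem_Ico.1 hl).2
  exact Finset.mem_range.2 (by omega)

theorem gamma_term_nonneg (hP : P.Admissible) (hη : 0 < A.η) (l : ℕ) :
    0 ≤ √n / A.η * (P.Lg / P.Lf) * (Real.exp (P.Lf * ((l : ℝ) / A.R)) - 1) := by
  have := hP.Lg_nonneg
  have := hP.Lf_pos
  have : 1 ≤ Real.exp (P.Lf * ((l : ℝ) / A.R)) := Real.one_le_exp (by positivity)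
  exact mul_nonneg (by positivity) (by linarith)

theorem sum_Ico_le_gammaSum (hP : P.Admissible) (hη : 0 < A.η) (j : ℕ) :
    ∑ l ∈ Finset.Ico j A.h,
      √n / A.η * (P.Lg / P.Lf) * (Real.exp (P.Lf * ((l : ℝ) / A.R)) - 1) ≤
      gammaSum P A A.h := by
  rw [gammaSum_eq]
  refine Finset.sum_le_sum_of_subset_of_nonneg (fun l hl => ?_)
    fun l _ _ => gamma_term_nonneg hP hη l
  have := (Finset.mem_Ico.1 hl).2
  exact Finset.mem_range.2 (by omega)

/-! ### The cost bound -/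

theorem IsSearchTree.exists_mem_queue (hn : 0 < n) (hP : P.Admissible) (hR : 0 < A.R)
    (hη : 0 < A.η) (hW : (A.W : Set (Vec m)) ⊆ P.Omega) {Q E Λ : Set (Str m)}
    (h : IsSearchTree P A (Q ∪ E) E Λ ∅) (hu : u ∈ stringSignals A)
    (hgoal : Str.toSignal A.R u ∈ P.preimage (P.goalInterior (deltaSum P A A.h))) :
    ∃ v ∈ Q, strCost P A v ≤ strCost P A u + gammaSum P A A.h := by
  obtain ⟨x, hx, hxu⟩ := hgoal
  have hball : ∀ t ∈ Icc 0 ((u.length : ℝ) / A.R),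
      Metric.ball (x.toFun t) (deltaSum P A A.h) ⊆ P.Xfree := by
    have := hx.1.2.2
    rwa [hxu.2.2.1] at this
  -- Induction on the unread suffix, for all nodes `v` at once since domination can jump anywhere in
  -- the tree. The sums start at `r.length`: replacements have happened only with at least that many
  -- letters left.
  have key : ∀ r : Str m, ∀ v ∈ Q ∪ E, NearOptimal P A u x.toFun v r
      (∑ l ∈ Finset.Ico r.length A.h, √n / A.η * Real.exp (P.Lf * ((l : ℝ) / A.R)))
      (∑ l ∈ Finset.Ico r.length A.h,
        √n / A.η * (P.Lg / P.Lf) * (Real.exp (P.Lf * ((l : ℝ) / A.R)) - 1)) →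
      ∃ v ∈ Q, strCost P A v ≤ strCost P A u + gammaSum P A A.h := by
    intro r
    induction r with
    | nil =>
      rintro v (hv | hv) hno
      · exact ⟨v, hv, (hno.strCost_le hP hR hW).trans (by gcongr; exact sum_Ico_le_gammaSum hP hη _)⟩
      · exact absurd (hno.mem_goalSignals hP hR hW hx hxu (sum_Ico_lt_deltaSum hn P hη _))
          (h.not_goal v hv)
    | cons a r ih =>
      rintro v (hv | hv) hno
      · exact ⟨v, hv, (hno.strCost_le hP hR hW).trans (by gcongr; exact sum_Ico_le_gammaSum hP hη _)⟩
      have hrh : r.length < A.h := by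
        have := hno.length_le
        rw [List.length_append, List.length_cons] at this
        omega
      have hadv := hno.advance
      have hne : v ++ [a] ≠ [] := by simp
      rw [List.length_cons] at hadv
      have hlt := sum_Ico_lt_deltaSum hn P (A := A) hη r.length
      -- The split-off term `l = r.length` is the error of a replacement at this letter.
      rw [Finset.sum_eq_sum_Ico_succ_bot hrh] at hlt
      rcases h.settled v hv a (hno.mem_W a (by simp)) with hs | hs | hs | hs | ⟨z, hz, hzf, hzw⟩
      · exact hs.elim
      · refine ih _ hs (hadv.mono ?_ ?_)
        · rw [Finset.sum_eq_sum_Ico_succ_bot hrh]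
          exact le_add_of_nonneg_left (by positivity)
        · rw [Finset.sum_eq_sum_Ico_succ_bot hrh]
          exact le_add_of_nonneg_left (gamma_term_nonneg hP hη _)
      · exact absurd (hadv.mem_freeSignals hP hR hW hne) hs
      · have := hadv.length_le
        rw [List.length_append] at this
        omega
      · have hzne : z ≠ [] := fun hnil => nil_notMem_freeSignals A.R (hnil ▸ hzf)
        refine ih z hz ?_
        rw [Finset.sum_eq_sum_Ico_succ_bot hrh, Finset.sum_eq_sum_Ico_succ_bot hrh]
        exact hadv.replace hP hR hη hW hball hne hzne
          ((h.mem_tree z hz).resolve_left hzne).1.2.2 hzf hzw hlt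
  have hδ : 0 < deltaSum P A A.h :=
    (Finset.sum_nonneg fun l _ => by positivity).trans_lt (sum_Ico_lt_deltaSum hn P hη 0)
  have h0 : NearOptimal P A u x.toFun [] u 0 0 :=
    ⟨hu.1, hu.2.2, hu.2.1, ⟨[], x.toFun, rfl, isTraj_of_isSolution hP hR hxu,
      fun t ht => hball t ht (Metric.mem_ball_self hδ), by simp⟩, by simp⟩
  exact key u [] h.root_mem (h0.mono (Finset.sum_nonneg fun l _ => by positivity)
    (Finset.sum_nonneg fun l _ => gamma_term_nonneg hP hη l))

/-- Subtracting the finite `γ_h` turns the claim into a lower bound for an infimum, which also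
covers the empty case. -/
theorem le_cEps_add_gammaSum {c : EReal} {ε : ℝ}
    (h : ∀ u ∈ stringSignals A, Str.toSignal A.R u ∈ P.preimage (P.goalInterior ε) →
      c ≤ ((strCost P A u + gammaSum P A A.h : ℝ) : EReal)) :
    c ≤ cEps P A ε + (gammaSum P A A.h : EReal) := by
  rw [← EReal.sub_le_iff_le_add (Or.inl (EReal.coe_ne_bot _)) (Or.inl (EReal.coe_ne_top _))]
  refine le_iInf₂ fun u hu => ?_
  rw [EReal.sub_le_iff_le_add (Or.inl (EReal.coe_ne_bot _)) (Or.inl (EReal.coe_ne_top _))]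
  exact_mod_cast h u hu.1 hu.2

end GLC

theorem theorem5p2 {n m : ℕ} (hn : 0 < n) (P : GLC.ProblemData n m) (hP : P.Admissible)
    (A : GLC.Params m) (hR : 0 < A.R) (hη : 0 < A.η) (hW : (A.W : Set (GLC.Vec m)) ⊆ P.Omega) :
    -- finite running time: there is a bound on the number of steps of all executions ...
    (∃ N : ℕ, ∀ (k : ℕ) (run : ℕ → GLC.State m), run 0 = GLC.start m →
      (∀ i < k, GLC.Step P A (run i) (run (i + 1))) → k ≤ N) ∧
    -- ... and an execution only stops by returning
    (∀ st, Relation.ReflTransGen (GLC.Step P A) (GLC.start m) st →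
      (∃ out, st = GLC.State.done out) ∨ ∃ st', GLC.Step P A st st') ∧
    -- the returned pair is `(∞, NULL)` or a solution with its cost, and the cost obeys the bound
    (∀ (c : EReal) (res : Option (GLC.Str m)),
      Relation.ReflTransGen (GLC.Step P A) (GLC.start m) (GLC.State.done (c, res)) →
      ((c = ⊤ ∧ res = none) ∨
        ∃ u ∈ GLC.stringSignals A, res = some u ∧
          GLC.Str.toSignal A.R u ∈ P.goalSignals ∧ c = (GLC.strCost P A u : EReal)) ∧
      c ≤ GLC.cEps P A (GLC.deltaSum P A A.h) + (GLC.gammaSum P A A.h : EReal)) := by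
  refine ⟨⟨_, fun k run h0 hrun => GLC.length_run_le h0 hrun⟩, fun st hst => ?_, fun c res h => ?_⟩
  · obtain ⟨N, hN⟩ := GLC.exists_budget_of_reachable hst
    exact GLC.done_or_exists_step hN
  · obtain ⟨Q, Λ, E, hE, hout⟩ := GLC.invariant_of_reachable h
    refine ⟨?_, GLC.le_cEps_add_gammaSum fun v hv hgoal => ?_⟩
    · rcases hout with ⟨-, hout⟩ | ⟨u, hu, hg, hout⟩
      · exact Or.inl (Prod.mk.inj hout)
      · obtain ⟨hc, hres⟩ := Prod.mk.inj hout
        have hfree := GLC.goalSignals_subset_freeSignals hg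
        have hne : u ≠ [] := fun hnil => GLC.nil_notMem_freeSignals A.R (hnil ▸ hfree)
        exact Or.inr ⟨u, ((hE.mem_tree u (Or.inl hu.1)).resolve_left hne).1, hres, hg, hc⟩
    · obtain ⟨v', hv', hle⟩ := hE.exists_mem_queue hn hP hR hη hW hv hgoal
      -- A competitor forces a node in the queue, so failure is excluded; otherwise the popped
      -- signal costs no more than `v'`.
      rcases hout with ⟨rfl, -⟩ | ⟨u, hu, hg, hout⟩
      · exact hv'.elim
      · rw [(Prod.mk.inj hout).1]
        exact EReal.coe_le_coe_iff.2 ((hu.2 v' hv').trans hle)
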